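/- Let $\Omega\subseteq\mathbb R^n$ be open, let $1<p<\infty$, $p'=p/(p-1)$, and let $a:\Omega\times(\mathbb R\times\mathbb R^n)\to\mathbb R^n$ and $b:\Omega\times(\mathbb R\times\mathbb R^n)\to\mathbb R$ be Carathéodory functions (measurable in $x$ for every $(s,\xi)$, continuous in $(s,\xi)$ for a.e. $x$) such that: (i) for every compact $C\subseteq\Omega$ and every $R>0$ there exist $\alpha^{(0)}_{C,R}\in L^1(C)$, $\alpha^{(1)}_{C,R}\in L^{p'}(C)$ and $\beta_{C,R}\ge 0$ with $$|a(x,s,\xi)|\le\alpha^{(1)}_{C,R}(x)+\beta_{C,R}|\xi|^{p-1},\qquad |b(x,s,\xi)|\le\alpha^{(0)}_{C,R}(x)+\beta_{C,R}|\xi|^{p}$$ for a.e. $x\in C$ and all $s\in\mathbb R$, $\xi\in\mathbb R^n$ with $|s|\le R$; (ii) $[a(x,s,\xi)-a(x,s,\hat\xi)]\cdot(\xi-\hat\xi)\ge 0$ for a.e. $x\in\Omega$ and all $s\in\mathbb R$, $\xi,\hat\xi\in\mathbb R^n$. Let $L^\infty_c(\Omega)$ denote the set of $v\in L^\infty(\Omega)$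 vanishing a.e. outside some compact subset of $\Omega$. A function $w\in W^{1,p}_{loc}(\Omega)\cap L^\infty_{loc}(\Omega)$ is called a supersolution (resp. subsolution) of $$-\mathrm{div}[a(x,u,\nabla u)]+b(x,u,\nabla u)=0\quad\text{in }\Omega$$ if $\int_\Omega[a(x,w,\nabla w)\cdot\nabla v+b(x,w,\nabla w)\,v]\,dx\ge 0$ (resp. $\le 0$) for every $v\in C^\infty_c(\Omega)$ with $v\ge 0$. Let $\underline u,u,\overline u\in W^{1,p}_{loc}(\Omega)\cap L^\infty_{loc}(\Omega)$ be such that $\underline u$ is a subsolution and $\overline u$ a supersolution of this equation, let $$K=\{v\in W^{1,p}_{loc}(\Omega)\cap L^\infty_{loc}(\Omega):\ \underline u\le v\le\overline u\ \text{a.e. in }\Omega\},$$ and suppose that $u\in K$ and $$\int_\Omega[a(x,u,\nabla u)\cdot\nabla(v-u)+b(x,u,\nabla u)(v-u)]\,dx\ge 0\qquad\text{for every } v\in K\text{ with } v-u\in L^\infty_c(\Omega).$$ Suppose also that (iii) for every compact $C\subseteq\Omega$ there exist $r_C>0$ and $\gamma_C\in L^{p'}(C)$ such that $$|a(x,s,\nabla\underline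 u(x))-a(x,\underline u(x),\nabla\underline u(x))|\le\gamma_C(x)\,(s-\underline u(x)),$$ $$|a(x,\overline u(x),\nabla\overline u(x))-a(x,\sigma,\nabla\overline u(x))|\le\gamma_C(x)\,(\overline u(x)-\sigma)$$ for a.e. $x\in C$ and all $s,\sigma\in\mathbb R$ with $\underline u(x)\le s\le\underline u(x)+r_C$ and $\overline u(x)-r_C\le\sigma\le\overline u(x)$. Then, for every $v\in W^{1,p}_0(\Omega)\cap L^\infty_c(\Omega)$, the function $a(x,u,\nabla u)\cdot\nabla v+b(x,u,\nabla u)\,v$ is integrable on $\Omega$ and $$\int_\Omega[a(x,u,\nabla u)\cdot\nabla v+b(x,u,\nabla u)\,v]\,dx=0.$$ -/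

import Mathlib

open MeasureTheory TopologicalSpace Filter
open scoped Distributions Topology ENNReal

namespace QuasilinearObstacle

noncomputable section

/-- The Euclidean space `ℝⁿ`. -/
abbrev Eucl (n : ℕ) : Type := EuclideanSpace ℝ (Fin n)

/-- `f : Ω × (ℝ × ℝⁿ) → F` is a Carathéodory function: `f(·, s, ξ)` is (Lebesgue) measurable on `Ω`
for every `(s, ξ)`, and `f(x, ·, ·)` is continuous for a.e. `x ∈ Ω`. Values at `x ∉ Ω` are
irrelevant. -/
structure IsCaratheodoryFun {n : ℕ} {F : Type*} [NormedAddCommGroup F]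
    (Ω : Opens (Eucl n)) (f : Eucl n → ℝ → Eucl n → F) : Prop where
  aestronglyMeasurable : ∀ (s : ℝ) (ξ : Eucl n),
    AEStronglyMeasurable (fun x => f x s ξ) (volume.restrict (Ω : Set (Eucl n)))
  continuous : ∀ᵐ x ∂(volume.restrict (Ω : Set (Eucl n))),
    Continuous (fun q : ℝ × Eucl n => f x q.1 q.2)

/-- `G` is a weak (distributional) gradient of `u` on the open set `Ω`. It is unique up to equality
a.e. in `Ω`, so `G` stands for `∇u` below. -/
structure IsWeakGradient {n : ℕ} (Ω : Opens (Eucl n)) (u : Eucl n → ℝ) (G : Eucl n → Eucl n) :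
    Prop where
  locallyIntegrableOn : LocallyIntegrableOn u (Ω : Set (Eucl n)) volume
  locallyIntegrableOn_grad : LocallyIntegrableOn G (Ω : Set (Eucl n)) volume
  integral_eq : ∀ φ : 𝓓(Ω, ℝ),
    ∫ x in (Ω : Set (Eucl n)), u x • gradient φ x = -∫ x in (Ω : Set (Eucl n)), φ x • G x

/-- `u ∈ L^q_loc(Ω)`: `u` is in `L^q(C)` for every compact `C ⊆ Ω`. -/
def MemLpLoc {n : ℕ} {F : Type*} [NormedAddCommGroup F]
    (Ω : Opens (Eucl n)) (q : ℝ≥0∞) (u : Eucl n → F) : Prop :=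
  ∀ C : Set (Eucl n), IsCompact C → C ⊆ Ω → MemLp u q (volume.restrict C)

/-- `u ∈ W^{1,p}_loc(Ω)` with weak gradient `G`. -/
structure MemW1pLoc {n : ℕ} (Ω : Opens (Eucl n)) (p : ℝ) (u : Eucl n → ℝ) (G : Eucl n → Eucl n) :
    Prop where
  isWeakGradient : IsWeakGradient Ω u G
  memLpLoc : MemLpLoc Ω (ENNReal.ofReal p) u
  memLpLoc_grad : MemLpLoc Ω (ENNReal.ofReal p) G

/-- `u ∈ W^{1,p}_loc(Ω) ∩ L^∞_loc(Ω)` with weak gradient `G`. -/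
structure MemW1pLocLinfLoc {n : ℕ} (Ω : Opens (Eucl n)) (p : ℝ) (u : Eucl n → ℝ)
    (G : Eucl n → Eucl n) : Prop where
  memW1pLoc : MemW1pLoc Ω p u G
  memLinfLoc : MemLpLoc Ω ∞ u

/-- `v ∈ W^{1,p}_0(Ω)` with weak gradient `G`: `v ∈ W^{1,p}(Ω)` is the limit, in the norm of
`W^{1,p}(Ω)`, of a sequence in `C^∞_c(Ω)`. -/
structure MemW1pZero {n : ℕ} (Ω : Opens (Eucl n)) (p : ℝ) (v : Eucl n → ℝ)
    (G : Eucl n → Eucl n) : Prop where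
  isWeakGradient : IsWeakGradient Ω v G
  memLp : MemLp v (ENNReal.ofReal p) (volume.restrict (Ω : Set (Eucl n)))
  memLp_grad : MemLp G (ENNReal.ofReal p) (volume.restrict (Ω : Set (Eucl n)))
  exists_approx : ∃ φ : ℕ → 𝓓(Ω, ℝ),
    Tendsto (fun k => eLpNorm (fun x => φ k x - v x) (ENNReal.ofReal p)
      (volume.restrict (Ω : Set (Eucl n)))) atTop (𝓝 0) ∧
    Tendsto (fun k => eLpNorm (fun x => gradient (φ k) x - G x) (ENNReal.ofReal p)
      (volume.restrict (Ω : Set (Eucl n)))) atTop (𝓝 0)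

/-- `v ∈ L^∞_c(Ω)`: `v ∈ L^∞(Ω)` and `v` vanishes a.e. outside some compact subset of `Ω`. -/
def MemLinfC {n : ℕ} (Ω : Opens (Eucl n)) (v : Eucl n → ℝ) : Prop :=
  MemLp v ∞ (volume.restrict (Ω : Set (Eucl n))) ∧
    ∃ C : Set (Eucl n), IsCompact C ∧ C ⊆ Ω ∧
      ∀ᵐ x ∂(volume.restrict (Ω : Set (Eucl n))), x ∉ C → v x = 0

/-- Local natural growth conditions of order `p` on `a` and `b`. -/
def LocalNaturalGrowth {n : ℕ} (Ω : Opens (Eucl n)) (p : ℝ)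
    (a : Eucl n → ℝ → Eucl n → Eucl n) (b : Eucl n → ℝ → Eucl n → ℝ) : Prop :=
  ∀ C : Set (Eucl n), IsCompact C → C ⊆ Ω → ∀ R : ℝ, 0 < R →
    ∃ (α₀ α₁ : Eucl n → ℝ) (β : ℝ),
      MemLp α₀ 1 (volume.restrict C) ∧
      MemLp α₁ (ENNReal.ofReal p.conjExponent) (volume.restrict C) ∧
      0 ≤ β ∧
      ∀ᵐ x ∂(volume.restrict C), ∀ (s : ℝ) (ξ : Eucl n), |s| ≤ R →
        ‖a x s ξ‖ ≤ α₁ x + β * ‖ξ‖ ^ (p - 1) ∧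
        |b x s ξ| ≤ α₀ x + β * ‖ξ‖ ^ p

/-- Monotonicity of `a` in the gradient variable. -/
def MonotoneInGradient {n : ℕ} (Ω : Opens (Eucl n)) (a : Eucl n → ℝ → Eucl n → Eucl n) : Prop :=
  ∀ᵐ x ∂(volume.restrict (Ω : Set (Eucl n))), ∀ (s : ℝ) (ξ η : Eucl n),
    0 ≤ inner ℝ (a x s ξ - a x s η) (ξ - η)

/-- The integrand `a(x, u, ∇u) · ∇v + b(x, u, ∇u) v`, with `Gu = ∇u` and `Gv = ∇v`. -/
def weakIntegrand {n : ℕ} (a : Eucl n → ℝ → Eucl n → Eucl n) (b : Eucl n → ℝ → Eucl n → ℝ)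
    (u : Eucl n → ℝ) (Gu : Eucl n → Eucl n) (v : Eucl n → ℝ) (Gv : Eucl n → Eucl n)
    (x : Eucl n) : ℝ :=
  inner ℝ (a x (u x) (Gu x)) (Gv x) + b x (u x) (Gu x) * v x

/-- `∫_Ω [a(x, u, ∇u) · ∇v + b(x, u, ∇u) v] dx`, with `Gu = ∇u` and `Gv = ∇v`. -/
def weakForm {n : ℕ} (Ω : Opens (Eucl n)) (a : Eucl n → ℝ → Eucl n → Eucl n)
    (b : Eucl n → ℝ → Eucl n → ℝ) (u : Eucl n → ℝ) (Gu : Eucl n → Eucl n)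
    (v : Eucl n → ℝ) (Gv : Eucl n → Eucl n) : ℝ :=
  ∫ x in (Ω : Set (Eucl n)), weakIntegrand a b u Gu v Gv x

/-- `w` (with weak gradient `Gw`) is a supersolution of `-div [a(x,u,∇u)] + b(x,u,∇u) = 0`. -/
structure IsSupersolution {n : ℕ} (Ω : Opens (Eucl n)) (p : ℝ)
    (a : Eucl n → ℝ → Eucl n → Eucl n) (b : Eucl n → ℝ → Eucl n → ℝ)
    (w : Eucl n → ℝ) (Gw : Eucl n → Eucl n) : Prop where
  mem : MemW1pLocLinfLoc Ω p w Gw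
  weakForm_nonneg : ∀ φ : 𝓓(Ω, ℝ), (∀ x, 0 ≤ φ x) → 0 ≤ weakForm Ω a b w Gw φ (gradient φ)

/-- `w` (with weak gradient `Gw`) is a subsolution of `-div [a(x,u,∇u)] + b(x,u,∇u) = 0`. -/
structure IsSubsolution {n : ℕ} (Ω : Opens (Eucl n)) (p : ℝ)
    (a : Eucl n → ℝ → Eucl n → Eucl n) (b : Eucl n → ℝ → Eucl n → ℝ)
    (w : Eucl n → ℝ) (Gw : Eucl n → Eucl n) : Prop where
  mem : MemW1pLocLinfLoc Ω p w Gw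
  weakForm_nonpos : ∀ φ : 𝓓(Ω, ℝ), (∀ x, 0 ≤ φ x) → weakForm Ω a b w Gw φ (gradient φ) ≤ 0

/-- `v` (with weak gradient `Gv`) belongs to the order interval `[lo, hi]` of
`W^{1,p}_loc(Ω) ∩ L^∞_loc(Ω)`. -/
structure MemOrderInterval {n : ℕ} (Ω : Opens (Eucl n)) (p : ℝ) (lo hi : Eucl n → ℝ)
    (v : Eucl n → ℝ) (Gv : Eucl n → Eucl n) : Prop where
  mem : MemW1pLocLinfLoc Ω p v Gv
  between : ∀ᵐ x ∂(volume.restrict (Ω : Set (Eucl n))), lo x ≤ v x ∧ v x ≤ hi x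

/-- `u` (with weak gradient `Gu`) solves the local variational inequality on the order interval
`[lo, hi]`. -/
structure SolvesLocalVI {n : ℕ} (Ω : Opens (Eucl n)) (p : ℝ)
    (a : Eucl n → ℝ → Eucl n → Eucl n) (b : Eucl n → ℝ → Eucl n → ℝ)
    (lo hi : Eucl n → ℝ) (u : Eucl n → ℝ) (Gu : Eucl n → Eucl n) : Prop where
  mem : MemOrderInterval Ω p lo hi u Gu
  weakForm_nonneg : ∀ (v : Eucl n → ℝ) (Gv : Eucl n → Eucl n),
    MemOrderInterval Ω p lo hi v Gv → MemLinfC Ω (fun x => v x - u x) →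
      0 ≤ weakForm Ω a b u Gu (fun x => v x - u x) (fun x => Gv x - Gu x)

/-- The Lipschitz-type condition on `a` with respect to `s` near the obstacles `lo` and `hi`, whose
weak gradients are `Glo` and `Ghi`. -/
def LipschitzNearObstacles {n : ℕ} (Ω : Opens (Eucl n)) (p : ℝ)
    (a : Eucl n → ℝ → Eucl n → Eucl n)
    (lo : Eucl n → ℝ) (Glo : Eucl n → Eucl n) (hi : Eucl n → ℝ) (Ghi : Eucl n → Eucl n) : Prop :=
  ∀ C : Set (Eucl n), IsCompact C → C ⊆ Ω →
    ∃ (r : ℝ) (γ : Eucl n → ℝ), 0 < r ∧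
      MemLp γ (ENNReal.ofReal p.conjExponent) (volume.restrict C) ∧
      ∀ᵐ x ∂(volume.restrict C), ∀ s σ : ℝ,
        lo x ≤ s → s ≤ lo x + r → hi x - r ≤ σ → σ ≤ hi x →
          ‖a x s (Glo x) - a x (lo x) (Glo x)‖ ≤ γ x * (s - lo x) ∧
          ‖a x (hi x) (Ghi x) - a x σ (Ghi x)‖ ≤ γ x * (hi x - σ)

end

end QuasilinearObstacle

/-! ### Mollification in `L^q` on the whole space. -/

namespace QuasilinearObstacle

open scoped Convolution

noncomputable section

variable {n : ℕ} {F : Type*} [NormedAddCommGroup F] [NormedSpace ℝ F]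

/-! Write W_w(v) for the weak form at w tested with v. It suffices to show W_u(v) ≥ 0 for all
bounded, compactly supported v, since -v is admissible too. As u + εv may leave the order interval,
it is truncated: with z = (u + εv - hi)⁺ and y = (lo - u - εv)⁺, the competitor u + εv + y - z lies
in it, and the variational inequality gives 0 ≤ ε W_u(v) + W_u(y) - W_u(z). Everything rests on
W_u(z) ≥ -o(ε) and W_u(y) ≤ o(ε); then one divides by ε and lets ε → 0.

For z (`weakForm_truncation_lower_bound`), the supersolution inequality W_hi(z) ≥ 0 reduces the
claim to W_u(z) - W_hi(z). On {z > 0}, the difference of fluxes splits at a(x, u, ∇hi): one piece is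
monotone in the gradient and has the good sign against ∇(u - hi), the other is at most γ(hi - u) <
γε|v| by the Lipschitz condition. All remaining terms carry a factor ε as well. Where u = hi the
gradients agree a.e. and the integrand vanishes, so only {0 < hi - u < ε|v|} matters. These sets
shrink to the empty set, and dominated convergence turns O(ε) into o(ε). The estimate for y is the
same one for the equation satisfied by -u (`weakForm_reflect`).

Two tools make this rigorous. Positive parts must be admissible, with gradient zero on the zero set
(`IsWeakGradient.posPart`, `IsWeakGradient.ae_eq_zero_of_eq_zero`, both from the chain rule
`IsWeakGradient.comp`). And the supersolution inequality, given for smooth test functions only, must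
hold for z (`integral_pairing_nonneg`). Both are obtained by mollification. -/

/-- The regularisation of `f` by the normalised bump function `ρ`. -/
def mollify (ρ : ContDiffBump (0 : Eucl n)) (f : Eucl n → F) : Eucl n → F :=
  ρ.normed volume ⋆[ContinuousLinearMap.lsmul ℝ ℝ, volume] f

/-- A sequence of bump functions whose supports shrink to the origin. -/
def shrinkingBump (n k : ℕ) : ContDiffBump (0 : Eucl n) where
  rIn := (1 / ((k : ℝ) + 1)) / 2
  rOut := 1 / ((k : ℝ) + 1)
  rIn_pos := by positivity
  rIn_lt_rOut := half_lt_self (by positivity)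

lemma tendsto_rOut_shrinkingBump :
    Tendsto (fun k => (shrinkingBump n k).rOut) atTop (𝓝 0) :=
  tendsto_one_div_add_atTop_nhds_zero_nat

lemma mollify_apply (ρ : ContDiffBump (0 : Eucl n)) (f : Eucl n → F) (x : Eucl n) :
    mollify ρ f x = ∫ y, ρ.normed volume y • f (x - y) := rfl

lemma mollify_apply_swap (ρ : ContDiffBump (0 : Eucl n)) (f : Eucl n → F) (x : Eucl n) :
    mollify ρ f x = ∫ y, ρ.normed volume (x - y) • f y :=
  convolution_lsmul_swap

lemma ae_tendsto_mollify {f : Eucl n → F} [CompleteSpace F] (hf : LocallyIntegrable f volume) :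
    ∀ᵐ x, Tendsto (fun k => mollify (shrinkingBump n k) f x) atTop (𝓝 (f x)) := by
  -- Convergence at almost every point needs the outer and inner radii to stay comparable; here
  -- their ratio is exactly 2.
  refine ContDiffBump.ae_convolution_tendsto_right_of_locallyIntegrable (K := 2)
    tendsto_rOut_shrinkingBump (Eventually.of_forall fun k => ?_) hf
  simp only [shrinkingBump]
  linarith

lemma contDiff_mollify (ρ : ContDiffBump (0 : Eucl n)) {f : Eucl n → F}
    (hf : LocallyIntegrable f volume) {m : ℕ∞} : ContDiff ℝ m (mollify ρ f) :=
  ρ.hasCompactSupport_normed.contDiff_convolution_left _ ρ.contDiff_normed hf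

lemma mollify_add (ρ : ContDiffBump (0 : Eucl n)) {f g : Eucl n → F}
    (hf : LocallyIntegrable f volume) (hg : LocallyIntegrable g volume) :
    mollify ρ (f + g) = mollify ρ f + mollify ρ g :=
  ConvolutionExists.distrib_add
    (ρ.hasCompactSupport_normed.convolutionExists_left _ ρ.continuous_normed hf)
    (ρ.hasCompactSupport_normed.convolutionExists_left _ ρ.continuous_normed hg)

lemma isProbabilityMeasure_withDensity_normed (ρ : ContDiffBump (0 : Eucl n)) :
    IsProbabilityMeasure
      ((volume : Measure (Eucl n)).withDensity fun y => ENNReal.ofReal (ρ.normed volume y)) := by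
  constructor
  rw [withDensity_apply _ MeasurableSet.univ, Measure.restrict_univ,
    ← ofReal_integral_eq_lintegral_ofReal ρ.integrable_normed
      (Eventually.of_forall ρ.nonneg_normed), ρ.integral_normed, ENNReal.ofReal_one]

/-- Jensen's inequality for a mollification. -/
lemma enorm_mollify_rpow_le (ρ : ContDiffBump (0 : Eucl n)) {f : Eucl n → F}
    (hf : StronglyMeasurable f) {q : ℝ} (hq : 1 ≤ q) (x : Eucl n) :
    ‖mollify ρ f x‖ₑ ^ q ≤ ∫⁻ y, ENNReal.ofReal (ρ.normed volume y) * ‖f (x - y)‖ₑ ^ q := by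
  have hq0 : 0 < q := zero_lt_one.trans_le hq
  -- The kernel is the density of a probability measure, for which the `L^1` norm is bounded by the
  -- `L^q` norm.
  set ν := (volume : Measure (Eucl n)).withDensity fun y => ENNReal.ofReal (ρ.normed volume y)
  have hprob : IsProbabilityMeasure ν := isProbabilityMeasure_withDensity_normed ρ
  have hρm : Measurable fun y : Eucl n => ENNReal.ofReal (ρ.normed volume y) :=
    ρ.continuous_normed.measurable.ennreal_ofReal
  have hfx : StronglyMeasurable fun y => f (x - y) :=
    hf.comp_measurable (measurable_const.sub measurable_id)
  have h1 : ‖mollify ρ f x‖ₑ ≤ eLpNorm (fun y => f (x - y)) 1 ν := by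
    rw [mollify_apply, eLpNorm_one_eq_lintegral_enorm,
      lintegral_withDensity_eq_lintegral_mul _ hρm hfx.enorm]
    refine (enorm_integral_le_lintegral_enorm _).trans (lintegral_mono fun y => ?_)
    rw [enorm_smul, Real.enorm_eq_ofReal (ρ.nonneg_normed y)]
    rfl
  have h2 : eLpNorm (fun y => f (x - y)) 1 ν ≤ eLpNorm (fun y => f (x - y)) (ENNReal.ofReal q) ν :=
    eLpNorm_le_eLpNorm_of_exponent_le (by simpa using hq) hfx.aestronglyMeasurable
  calc ‖mollify ρ f x‖ₑ ^ q ≤ eLpNorm (fun y => f (x - y)) (ENNReal.ofReal q) ν ^ q :=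
        ENNReal.rpow_le_rpow (h1.trans h2) hq0.le
    _ = ∫⁻ y, ‖f (x - y)‖ₑ ^ q ∂ν := by
        rw [eLpNorm_eq_lintegral_rpow_enorm_toReal (by simpa using hq0) ENNReal.ofReal_ne_top,
          ENNReal.toReal_ofReal hq0.le, ← ENNReal.rpow_mul, one_div_mul_cancel hq0.ne',
          ENNReal.rpow_one]
    _ = _ := by
        rw [lintegral_withDensity_eq_lintegral_mul _ hρm (hfx.enorm.pow_const q)]
        rfl

/-- Mollification does not increase the `L^q` norm. -/
lemma eLpNorm_mollify_le (ρ : ContDiffBump (0 : Eucl n)) {f : Eucl n → F}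
    (hf : AEStronglyMeasurable f volume) {q : ℝ} (hq : 1 ≤ q) :
    eLpNorm (mollify ρ f) (ENNReal.ofReal q) volume ≤ eLpNorm f (ENNReal.ofReal q) volume := by
  have hq0 : 0 < q := zero_lt_one.trans_le hq
  have hcongr : mollify ρ f = mollify ρ (hf.mk f) :=
    convolution_congr _ (ae_eq_refl _) hf.ae_eq_mk
  rw [hcongr, eLpNorm_congr_ae hf.ae_eq_mk]
  set g := hf.mk f
  have hg : StronglyMeasurable g := hf.stronglyMeasurable_mk
  have hgm : Measurable fun y => ‖g y‖ₑ ^ q := hg.enorm.pow_const q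
  have hρm : Measurable fun y : Eucl n => ENNReal.ofReal (ρ.normed volume y) :=
    ρ.continuous_normed.measurable.ennreal_ofReal
  have hρ1 : ∫⁻ y : Eucl n, ENNReal.ofReal (ρ.normed volume y) = 1 := by
    rw [← ofReal_integral_eq_lintegral_ofReal ρ.integrable_normed
      (Eventually.of_forall ρ.nonneg_normed), ρ.integral_normed, ENNReal.ofReal_one]
  rw [eLpNorm_eq_lintegral_rpow_enorm_toReal (by simpa using hq0) ENNReal.ofReal_ne_top,
    eLpNorm_eq_lintegral_rpow_enorm_toReal (by simpa using hq0) ENNReal.ofReal_ne_top,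
    ENNReal.toReal_ofReal hq0.le]
  refine ENNReal.rpow_le_rpow ?_ (by positivity)
  calc ∫⁻ x, ‖mollify ρ g x‖ₑ ^ q
      ≤ ∫⁻ x, ∫⁻ y, ENNReal.ofReal (ρ.normed volume y) * ‖g (x - y)‖ₑ ^ q :=
        lintegral_mono fun x => enorm_mollify_rpow_le ρ hg hq x
    _ = ∫⁻ y, ∫⁻ x, ENNReal.ofReal (ρ.normed volume y) * ‖g (x - y)‖ₑ ^ q := by
        refine lintegral_lintegral_swap (Measurable.aemeasurable ?_)
        exact (hρm.comp measurable_snd).mul (hgm.comp (measurable_fst.sub measurable_snd))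
    _ = ∫⁻ y, ENNReal.ofReal (ρ.normed volume y) * ∫⁻ x, ‖g x‖ₑ ^ q := by
        refine lintegral_congr fun y => ?_
        have hgy : Measurable fun x => ‖g (x - y)‖ₑ ^ q := hgm.comp (measurable_id.sub_const y)
        rw [lintegral_const_mul _ hgy, lintegral_sub_right_eq_self (fun x => ‖g x‖ₑ ^ q) y]
    _ = ∫⁻ x, ‖g x‖ₑ ^ q := by
        rw [lintegral_mul_const _ hρm, hρ1, one_mul]

/-- By uniform continuity the error is uniformly small, and it vanishes outside a fixed compact
thickening of the support, so its norm is at most a small constant times a fixed power of the volume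
of that set. -/
lemma tendsto_eLpNorm_mollify_sub_of_continuous [CompleteSpace F] {g : Eucl n → F}
    (hg : Continuous g) (hgc : HasCompactSupport g) {q : ℝ} :
    Tendsto (fun k => eLpNorm (mollify (shrinkingBump n k) g - g) (ENNReal.ofReal q) volume)
      atTop (𝓝 0) := by
  set K := Metric.cthickening 1 (tsupport g)
  have hK : IsCompact K := hgc.isCompact.cthickening
  set c : ℝ≥0∞ := volume K ^ (1 / (ENNReal.ofReal q).toReal)
  have hc : c ≠ ∞ := ENNReal.rpow_ne_top_of_nonneg (by positivity) hK.measure_lt_top.ne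
  have hbound : ∀ η : ℝ, 0 < η → ∀ᶠ k in atTop,
      eLpNorm (mollify (shrinkingBump n k) g - g) (ENNReal.ofReal q) volume
        ≤ ENNReal.ofReal η * c := by
    intro η hη
    obtain ⟨δ, hδ, hδg⟩ := Metric.uniformContinuous_iff.1
      (hgc.uniformContinuous_of_continuous hg) η hη
    have hev : ∀ᶠ k in atTop, (shrinkingBump n k).rOut < min δ 1 :=
      tendsto_rOut_shrinkingBump.eventually_lt_const (by positivity)
    filter_upwards [hev] with k hk
    have hpt : ∀ x, ‖(mollify (shrinkingBump n k) g - g) x‖ ≤ ‖K.indicator (fun _ => η) x‖ := by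
      intro x
      by_cases hx : x ∈ K
      · rw [Set.indicator_of_mem hx, Real.norm_of_nonneg hη.le, Pi.sub_apply, ← dist_eq_norm]
        refine ContDiffBump.dist_normed_convolution_le hg.aestronglyMeasurable fun y hy => ?_
        exact (hδg ((Metric.mem_ball.1 hy).trans (hk.trans_le (min_le_left _ _)))).le
      · have hzero : ∀ y ∈ Metric.ball x (shrinkingBump n k).rOut, g y = 0 := by
          intro y hy
          by_contra hne
          refine hx (Metric.mem_cthickening_of_dist_le x y 1 _
            (subset_tsupport g (Function.mem_support.2 hne)) ?_)
          rw [dist_comm]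
          exact ((Metric.mem_ball.1 hy).trans (hk.trans_le (min_le_right _ _))).le
        have hx0 : g x = 0 := hzero x (Metric.mem_ball_self (shrinkingBump n k).rOut_pos)
        have : mollify (shrinkingBump n k) g x = g x :=
          ContDiffBump.normed_convolution_eq_right fun y hy => by rw [hzero y hy, hx0]
        simp [this]
    refine (eLpNorm_mono hpt).trans ((eLpNorm_indicator_const_le η _).trans ?_)
    rw [Real.enorm_eq_ofReal hη.le]
  rw [ENNReal.tendsto_nhds_zero]
  intro ε hε
  rcases eq_or_ne ε ∞ with rfl | hε'
  · simp
  -- The uniform error is taken to be ε / (c + 1); the added 1 covers c = 0.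
  have hηpos : 0 < (ε / (c + 1)).toReal :=
    ENNReal.toReal_pos (ENNReal.div_pos hε.ne' (by simp [hc])).ne'
      (ENNReal.div_lt_top hε' (by simp)).ne
  filter_upwards [hbound _ hηpos] with k hk
  refine hk.trans ?_
  rw [ENNReal.ofReal_toReal (ENNReal.div_lt_top hε' (by simp)).ne]
  calc ε / (c + 1) * c ≤ ε / (c + 1) * (c + 1) := by gcongr; exact le_self_add
    _ = ε := ENNReal.div_mul_cancel (by simp) (by simp [hc])

/-- Mollifications converge in `L^q`, `1 ≤ q < ∞`. -/
theorem tendsto_eLpNorm_mollify_sub [CompleteSpace F] {f : Eucl n → F} {q : ℝ} (hq : 1 ≤ q)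
    (hf : MemLp f (ENNReal.ofReal q) volume) :
    Tendsto (fun k => eLpNorm (mollify (shrinkingBump n k) f - f) (ENNReal.ofReal q) volume)
      atTop (𝓝 0) := by
  have hq1 : 1 ≤ ENNReal.ofReal q := by simpa using hq
  rw [ENNReal.tendsto_nhds_zero]
  intro ε hε
  have hε3 : ε / 3 ≠ 0 := (ENNReal.div_pos hε.ne' (by simp)).ne'
  obtain ⟨g, hgc, hfg, hg, hgL⟩ :=
    hf.exists_hasCompactSupport_eLpNorm_sub_le ENNReal.ofReal_ne_top hε3
  filter_upwards [(ENNReal.tendsto_nhds_zero.1 (tendsto_eLpNorm_mollify_sub_of_continuous hg hgc))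
    (ε / 3) (pos_iff_ne_zero.2 hε3)] with k hk
  set ρ := shrinkingBump n k
  have hd : MemLp (f - g) (ENNReal.ofReal q) volume := hf.sub hgL
  have hdl := hd.locallyIntegrable hq1
  have hgl := hgL.locallyIntegrable hq1
  have hfeq : mollify ρ f = mollify ρ (f - g) + mollify ρ g := by
    rw [← mollify_add ρ hdl hgl, sub_add_cancel]
  have hsplit : mollify ρ f - f = (mollify ρ (f - g) + (mollify ρ g - g)) - (f - g) := by
    rw [hfeq]; abel
  have hm1 : AEStronglyMeasurable (mollify ρ (f - g)) volume :=
    (contDiff_mollify (m := 0) ρ hdl).continuous.aestronglyMeasurable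
  have hm2 : AEStronglyMeasurable (mollify ρ g - g) volume :=
    ((contDiff_mollify (m := 0) ρ hgl).continuous.sub hg).aestronglyMeasurable
  rw [hsplit]
  calc _ ≤ eLpNorm (mollify ρ (f - g)) (ENNReal.ofReal q) volume
          + eLpNorm (mollify ρ g - g) (ENNReal.ofReal q) volume
          + eLpNorm (f - g) (ENNReal.ofReal q) volume :=
        (eLpNorm_sub_le (hm1.add hm2) hd.aestronglyMeasurable hq1).trans
          (add_le_add_left (eLpNorm_add_le hm1 hm2 hq1) _)
    _ ≤ ε / 3 + ε / 3 + ε / 3 :=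
        add_le_add (add_le_add ((eLpNorm_mollify_le ρ hd.aestronglyMeasurable hq).trans hfg) hk) hfg
    _ = ε := ENNReal.add_thirds ε

end

end QuasilinearObstacle
-- Mollification commutes with the weak gradient; integration by parts for `C¹` functions.
namespace QuasilinearObstacle

noncomputable section

variable {n : ℕ} {Ω : Opens (Eucl n)}

/-- The derivative of a convolution falls on the kernel. The hypothesis is the distributional
identity tested with y ↦ ρ(x - y), and moves it onto `f`; the minus sign there cancels the one from
differentiating in y instead of x. -/
lemma hasGradientAt_mollify_of_integral_eq (ρ : ContDiffBump (0 : Eucl n)) {f : Eucl n → ℝ}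
    {g : Eucl n → Eucl n} (hf : LocallyIntegrable f volume) (x : Eucl n)
    (h : ∫ y, f y • gradient (fun y => ρ.normed volume (x - y)) y
      = -∫ y, ρ.normed volume (x - y) • g y) :
    HasGradientAt (mollify ρ f) (mollify ρ g x) x := by
  have hρ : ContDiff ℝ 1 (ρ.normed volume) := ρ.contDiff_normed (n := 1)
  have hρd : Differentiable ℝ (ρ.normed volume) := hρ.differentiable (by norm_num)
  have hD := ρ.hasCompactSupport_normed.hasFDerivAt_convolution_left
    (ContinuousLinearMap.lsmul ℝ ℝ) hρ hf x
  have hint := ((ρ.hasCompactSupport_normed.fderiv (𝕜 := ℝ)).convolutionExists_left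
    (ContinuousLinearMap.precompL (Eucl n) (ContinuousLinearMap.lsmul ℝ ℝ))
    (hρ.continuous_fderiv (by norm_num)) hf x).integrable_swap
  rw [convolution_eq_swap] at hD
  have hfd : ∀ y e, fderiv ℝ (fun y => ρ.normed volume (x - y)) y e
      = - fderiv ℝ (ρ.normed volume) (x - y) e := by
    intro y e
    have h1 : HasFDerivAt (fun y : Eucl n => x - y) (-ContinuousLinearMap.id ℝ (Eucl n)) y :=
      (hasFDerivAt_id y).const_sub x
    have h2 := ((hρd (x - y)).hasFDerivAt).comp y h1
    have h3 : fderiv ℝ (fun y => ρ.normed volume (x - y)) y = _ := h2.fderiv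
    rw [h3]
    simp
  have hgi : Integrable (fun y => f y • gradient (fun y => ρ.normed volume (x - y)) y) := by
    have hcs : HasCompactSupport fun y => ρ.normed volume (x - y) :=
      ρ.hasCompactSupport_normed.comp_homeomorph (Homeomorph.subLeft x)
    have hcd : ContDiff ℝ 1 fun y => ρ.normed volume (x - y) :=
      hρ.comp (contDiff_const.sub contDiff_id)
    have hcg : Continuous (gradient fun y => ρ.normed volume (x - y)) :=
      (InnerProductSpace.toDual ℝ (Eucl n)).symm.continuous.comp
        (hcd.continuous_fderiv (by norm_num))
    refine hf.integrable_smul_right_of_hasCompactSupport hcg ?_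
    exact (hcs.fderiv (𝕜 := ℝ)).comp_left (map_zero _)
  rw [hasGradientAt_iff_hasFDerivAt]
  refine hD.congr_fderiv (ContinuousLinearMap.ext fun e => Eq.symm ?_)
  rw [ContinuousLinearMap.integral_apply hint, InnerProductSpace.toDual_apply_apply,
    mollify_apply_swap, ← neg_neg (∫ y, ρ.normed volume (x - y) • g y), ← h, inner_neg_left,
    real_inner_comm, ← integral_inner hgi, ← integral_neg]
  refine integral_congr_ae (Eventually.of_forall fun y => ?_)
  simp only [inner_smul_right, ContinuousLinearMap.precompL_apply,
    ContinuousLinearMap.lsmul_apply, smul_eq_mul]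
  rw [real_inner_comm, inner_gradient_left, hfd]
  ring

/-- The translated, reflected kernel of a mollification, as a test function. -/
def bumpTestFunction (ρ : ContDiffBump (0 : Eucl n)) (x : Eucl n)
    (hx : Metric.closedBall x ρ.rOut ⊆ Ω) : 𝓓(Ω, ℝ) where
  toFun y := ρ.normed volume (x - y)
  contDiff' := ρ.contDiff_normed.comp (contDiff_const.sub contDiff_id)
  hasCompactSupport' := ρ.hasCompactSupport_normed.comp_homeomorph (Homeomorph.subLeft x)
  tsupport_subset' := by
    refine (closure_minimal (fun y hy => ?_) Metric.isClosed_closedBall).trans hx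
    rw [Function.mem_support, ← Function.mem_support (f := ρ.normed volume), ρ.support_normed_eq,
      mem_ball_zero_iff, ← dist_eq_norm, dist_comm] at hy
    exact hy.le

lemma gradient_eq_zero_of_notMem_tsupport {φ : Eucl n → ℝ} {x : Eucl n} (hx : x ∉ tsupport φ) :
    gradient φ x = 0 := by
  have h : fderiv ℝ φ x = 0 := by
    by_contra hne
    exact hx (support_fderiv_subset ℝ (Function.mem_support.2 hne))
  simp [gradient, h]

lemma normed_sub_eq_zero_of_notMem (ρ : ContDiffBump (0 : Eucl n)) {x y : Eucl n}
    (hy : y ∉ Metric.closedBall x ρ.rOut) : ρ.normed volume (x - y) = 0 := by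
  by_contra hne
  rw [← ne_eq, ← Function.mem_support (f := ρ.normed volume), ρ.support_normed_eq,
    mem_ball_zero_iff, ← dist_eq_norm, dist_comm] at hne
  exact hy hne.le

lemma tsupport_normed_sub_subset (ρ : ContDiffBump (0 : Eucl n)) (x : Eucl n) :
    tsupport (fun y => ρ.normed volume (x - y)) ⊆ Metric.closedBall x ρ.rOut :=
  closure_minimal (fun _ hy => by_contra fun h => hy (normed_sub_eq_zero_of_notMem ρ h))
    Metric.isClosed_closedBall

/-- The gradient of a mollification is the mollification of the weak gradient. -/
theorem IsWeakGradient.hasGradientAt_mollify {u : Eucl n → ℝ} {G : Eucl n → Eucl n}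
    (h : IsWeakGradient Ω u G) (ρ : ContDiffBump (0 : Eucl n)) {f : Eucl n → ℝ}
    {g : Eucl n → Eucl n} (hf : LocallyIntegrable f volume) {x : Eucl n}
    (hx : Metric.closedBall x ρ.rOut ⊆ Ω)
    (hfu : ∀ᵐ y, y ∈ Metric.closedBall x ρ.rOut → f y = u y)
    (hgG : ∀ᵐ y, y ∈ Metric.closedBall x ρ.rOut → g y = G y) :
    HasGradientAt (mollify ρ f) (mollify ρ g x) x := by
  refine hasGradientAt_mollify_of_integral_eq ρ hf x ?_
  have key := h.integral_eq (bumpTestFunction ρ x hx)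
  have hcoe : ⇑(bumpTestFunction ρ x hx) = fun y => ρ.normed volume (x - y) := rfl
  rw [hcoe] at key
  have hg0 : ∀ y ∉ Metric.closedBall x ρ.rOut,
      gradient (fun y => ρ.normed volume (x - y)) y = 0 := fun y hy =>
    gradient_eq_zero_of_notMem_tsupport fun h => hy (tsupport_normed_sub_subset ρ x h)
  rw [setIntegral_eq_integral_of_forall_compl_eq_zero, setIntegral_eq_integral_of_forall_compl_eq_zero]
    at key
  · convert key using 1
    · refine integral_congr_ae (hfu.mono fun y hy => ?_)
      by_cases hyb : y ∈ Metric.closedBall x ρ.rOut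
      · simp only [hy hyb]
      · simp only [hg0 y hyb, smul_zero]
    · congr 1
      refine integral_congr_ae (hgG.mono fun y hy => ?_)
      by_cases hyb : y ∈ Metric.closedBall x ρ.rOut
      · simp only [hy hyb]
      · simp only [normed_sub_eq_zero_of_notMem ρ hyb, zero_smul]
  · intro y hy
    simp only [normed_sub_eq_zero_of_notMem ρ fun h => hy (hx h), zero_smul]
  · intro y hy
    rw [hg0 y fun h => hy (hx h), smul_zero]

/-- Pairing with a fixed vector e reduces the identity to scalar integration by parts for the
directional derivative along e. -/
lemma integral_smul_gradient_eq_neg {g φ : Eucl n → ℝ} (hg : ContDiff ℝ 1 g)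
    (hφ : ContDiff ℝ 1 φ) (hφc : HasCompactSupport φ) :
    ∫ x, g x • gradient φ x = -∫ x, φ x • gradient g x := by
  have hcont : ∀ {f : Eucl n → ℝ}, ContDiff ℝ 1 f → Continuous (gradient f) := fun hf =>
    (InnerProductSpace.toDual ℝ (Eucl n)).symm.continuous.comp (hf.continuous_fderiv (by norm_num))
  have hφg : HasCompactSupport (gradient φ) :=
    (hφc.fderiv (𝕜 := ℝ)).comp_left (map_zero _)
  have h1 : Integrable fun x => g x • gradient φ x :=
    (hg.continuous.smul (hcont hφ)).integrable_of_hasCompactSupport hφg.smul_left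
  have h2 : Integrable fun x => φ x • gradient g x :=
    (hφ.continuous.smul (hcont hg)).integrable_of_hasCompactSupport hφc.smul_right
  refine ext_inner_left ℝ fun e => ?_
  rw [inner_neg_right, ← integral_inner h1, ← integral_inner h2]
  have e1 : ∀ x, inner ℝ e (g x • gradient φ x) = g x * fderiv ℝ φ x e := fun x => by
    rw [inner_smul_right, real_inner_comm, inner_gradient_left]
  have e2 : ∀ x, inner ℝ e (φ x • gradient g x) = fderiv ℝ g x e * φ x := fun x => by
    rw [inner_smul_right, real_inner_comm, inner_gradient_left, mul_comm]
  have i1 := h1.const_inner (𝕜 := ℝ) e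
  have i2 := h2.const_inner (𝕜 := ℝ) e
  simp only [e1, e2] at i1 i2 ⊢
  refine integral_mul_fderiv_eq_neg_fderiv_mul_of_integrable i2 i1 ?_
    (fun x _ => hg.differentiable (by norm_num) x) (fun x _ => hφ.differentiable (by norm_num) x)
  exact (hg.continuous.mul hφ.continuous).integrable_of_hasCompactSupport hφc.mul_left

end

end QuasilinearObstacle
-- Chain rule for weak gradients.
namespace QuasilinearObstacle

noncomputable section

variable {n : ℕ} {Ω : Opens (Eucl n)} {F : Type*} [NormedAddCommGroup F]

lemma locallyIntegrableOn_of_norm_le {E : Type*} [NormedAddCommGroup E] {u : Eucl n → F}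
    {U : Eucl n → E}
    (hu : AEStronglyMeasurable u (volume.restrict (Ω : Set (Eucl n))))
    (hU : LocallyIntegrableOn U (Ω : Set (Eucl n)) volume)
    (h : ∀ᵐ x ∂(volume.restrict (Ω : Set (Eucl n))), ‖u x‖ ≤ ‖U x‖) :
    LocallyIntegrableOn u (Ω : Set (Eucl n)) volume := by
  rw [locallyIntegrableOn_iff Ω.isOpen.isLocallyClosed]
  intro K hKΩ hK
  exact Integrable.mono (hU.integrableOn_compact_subset hKΩ hK) (hu.mono_set hKΩ)
    (ae_restrict_of_ae_restrict_of_subset hKΩ h)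

lemma continuous_gradient {φ : Eucl n → ℝ} (hφ : ContDiff ℝ 1 φ) : Continuous (gradient φ) :=
  (InnerProductSpace.toDual ℝ (Eucl n)).symm.continuous.comp (hφ.continuous_fderiv (by norm_num))

lemma TestFunction.contDiff_one (φ : 𝓓(Ω, ℝ)) : ContDiff ℝ 1 φ :=
  φ.contDiff.of_le (by exact_mod_cast le_top)

lemma hasCompactSupport_gradient {φ : Eucl n → ℝ} (hφ : HasCompactSupport φ) :
    HasCompactSupport (gradient φ) :=
  (hφ.fderiv (𝕜 := ℝ)).comp_left (map_zero _)

lemma TestFunction.exists_bound (φ : 𝓓(Ω, ℝ)) :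
    ∃ C, 0 ≤ C ∧ (∀ x, |φ x| ≤ C) ∧ ∀ x, ‖gradient φ x‖ ≤ C := by
  obtain ⟨C₁, h₁⟩ := φ.hasCompactSupport.exists_bound_of_continuous φ.continuous
  obtain ⟨C₂, h₂⟩ := (hasCompactSupport_gradient φ.hasCompactSupport).exists_bound_of_continuous
    (continuous_gradient (TestFunction.contDiff_one φ))
  refine ⟨max C₁ C₂, ((abs_nonneg _).trans (h₁ 0)).trans (le_max_left _ _),
    fun x => (h₁ x).trans (le_max_left _ _), fun x => (h₂ x).trans (le_max_right _ _)⟩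

lemma TestFunction.eq_zero_of_notMem (φ : 𝓓(Ω, ℝ)) {x : Eucl n} (hx : x ∉ tsupport φ) :
    φ x = 0 := image_eq_zero_of_notMem_tsupport hx

lemma tendsto_integral_of_norm_sub_le {E : Type*} [NormedAddCommGroup E] [NormedSpace ℝ E]
    {Φ : ℕ → Eucl n → E} {Ψ : Eucl n → E} {d : ℕ → Eucl n → F} {c : ℝ}
    (hΨ : AEStronglyMeasurable Ψ volume) (hΦ : ∀ᶠ k in atTop, Integrable (Φ k) volume)
    (hd : Tendsto (fun k => eLpNorm (d k) 1 volume) atTop (𝓝 0))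
    (h : ∀ k x, ‖Φ k x - Ψ x‖ ≤ c * ‖d k x‖) :
    Tendsto (fun k => ∫ x, Φ k x) atTop (𝓝 (∫ x, Ψ x)) := by
  refine tendsto_integral_of_L1' Ψ hΨ hΦ ?_
  have h0 : Tendsto (fun k => ENNReal.ofReal c * eLpNorm (d k) 1 volume) atTop (𝓝 0) := by
    simpa using ENNReal.Tendsto.const_mul hd (Or.inr ENNReal.ofReal_ne_top)
  exact tendsto_of_tendsto_of_tendsto_of_le_of_le tendsto_const_nhds h0 (fun _ => zero_le)
    fun k => eLpNorm_le_mul_eLpNorm_of_ae_le_mul (Eventually.of_forall fun x => h k x) 1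

/-- Chain rule for weak gradients and `C¹` functions with bounded derivative. -/
theorem IsWeakGradient.comp {w : Eucl n → ℝ} {G : Eucl n → Eucl n} (h : IsWeakGradient Ω w G)
    {f : ℝ → ℝ} (hf : ContDiff ℝ 1 f) {L : ℝ} (hL : ∀ t, |deriv f t| ≤ L) :
    IsWeakGradient Ω (fun x => f (w x)) (fun x => deriv f (w x) • G x) := by
  have hL0 : 0 ≤ L := (abs_nonneg _).trans (hL 0)
  have hfd : Differentiable ℝ f := hf.differentiable (by norm_num)
  have hf' : Continuous (deriv f) := hf.continuous_deriv (by norm_num)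
  have hlip : ∀ s t, |f s - f t| ≤ L * |s - t| := fun s t =>
    Convex.norm_image_sub_le_of_norm_deriv_le (fun x _ => hfd x) (fun x _ => hL x)
      convex_univ (Set.mem_univ t) (Set.mem_univ s)
  have hwm := h.locallyIntegrableOn.aestronglyMeasurable
  have hGm := h.locallyIntegrableOn_grad.aestronglyMeasurable
  refine ⟨?_, ?_, fun φ => ?_⟩
  · have hU : LocallyIntegrableOn (fun x => |f 0| + L * |w x|) (Ω : Set (Eucl n)) volume :=
      (continuous_const.locallyIntegrable.locallyIntegrableOn _).add
        (h.locallyIntegrableOn.norm.smul L)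
    refine locallyIntegrableOn_of_norm_le (hf.continuous.comp_aestronglyMeasurable hwm) hU
      (Eventually.of_forall fun x => ?_)
    have h1 := hlip (w x) 0
    rw [sub_zero] at h1
    have h2 := abs_sub_abs_le_abs_sub (f (w x)) (f 0)
    rw [Real.norm_eq_abs, Real.norm_of_nonneg (by positivity)]
    linarith
  · refine locallyIntegrableOn_of_norm_le ((hf'.comp_aestronglyMeasurable hwm).smul hGm)
      (h.locallyIntegrableOn_grad.smul L) (Eventually.of_forall fun x => ?_)
    rw [norm_smul, Pi.smul_apply, norm_smul, Real.norm_of_nonneg hL0]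
    gcongr
    exact hL _
  obtain ⟨δ, hδ, hδΩ⟩ := φ.hasCompactSupport.isCompact.exists_cthickening_subset_open Ω.isOpen
    φ.tsupport_subset
  obtain ⟨C, hC0, hC1, hC2⟩ := TestFunction.exists_bound φ
  -- A thickening of the support of φ: cutting `w` and `G` off outside it makes them globally
  -- integrable, yet fine mollifications at points of that support see only the original functions.
  set K := Metric.cthickening δ (tsupport φ)
  have hK : IsCompact K := φ.hasCompactSupport.isCompact.cthickening
  have hφK : tsupport φ ⊆ K := Metric.self_subset_cthickening _
  set W := K.indicator w
  set H := K.indicator G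
  have hW : Integrable W :=
    (h.locallyIntegrableOn.integrableOn_compact_subset hδΩ hK).integrable_indicator
      hK.measurableSet
  have hH : Integrable H :=
    (h.locallyIntegrableOn_grad.integrableOn_compact_subset hδΩ hK).integrable_indicator
      hK.measurableSet
  set w' := fun k => mollify (shrinkingBump n k) W
  set H' := fun k => mollify (shrinkingBump n k) H
  have hw'd : ∀ k, ContDiff ℝ 1 (w' k) := fun k =>
    contDiff_mollify (m := 1) _ hW.locallyIntegrable
  have hH'c : ∀ k, Continuous (H' k) := fun k =>
    (contDiff_mollify (m := 0) _ hH.locallyIntegrable).continuous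
  have hwL : Tendsto (fun k => eLpNorm (w' k - W) 1 volume) atTop (𝓝 0) := by
    simpa using tendsto_eLpNorm_mollify_sub le_rfl (by simpa using memLp_one_iff_integrable.2 hW)
  have hHL : Tendsto (fun k => eLpNorm (H' k - H) 1 volume) atTop (𝓝 0) := by
    simpa using tendsto_eLpNorm_mollify_sub le_rfl (by simpa using memLp_one_iff_integrable.2 hH)
  have hae : ∀ᵐ x, Tendsto (fun k => w' k x) atTop (𝓝 (W x)) :=
    ae_tendsto_mollify hW.locallyIntegrable
  have hφ1 := TestFunction.contDiff_one φ
  have hgφ := continuous_gradient hφ1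
  have hgφc := hasCompactSupport_gradient φ.hasCompactSupport
  have hlim1 : Tendsto (fun k => ∫ x, f (w' k x) • gradient φ x) atTop
      (𝓝 (∫ x, f (W x) • gradient φ x)) := by
    refine tendsto_integral_of_norm_sub_le (d := fun k => w' k - W) (c := L * C)
      ((hf.continuous.comp_aestronglyMeasurable hW.aestronglyMeasurable).smul
        hgφ.aestronglyMeasurable)
      (Eventually.of_forall fun k => ?_) hwL fun k x => ?_
    · exact ((hf.continuous.comp (hw'd k).continuous).smul hgφ).integrable_of_hasCompactSupport
        hgφc.smul_left
    · rw [← sub_smul, norm_smul, Real.norm_eq_abs, Pi.sub_apply, Real.norm_eq_abs]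
      calc _ ≤ L * |w' k x - W x| * C :=
            mul_le_mul (hlip _ _) (hC2 x) (norm_nonneg _) (by positivity)
        _ = _ := by ring
  have hbd : ∀ t x, |φ x * deriv f t| ≤ C * L := fun t x => by
    rw [abs_mul]; exact mul_le_mul (hC1 x) (hL t) (abs_nonneg _) hC0
  have hint1 : ∀ k, Integrable fun x => (φ x * deriv f (w' k x)) • H' k x := fun k =>
    ((φ.continuous.mul (hf'.comp (hw'd k).continuous)).smul
      (hH'c k)).integrable_of_hasCompactSupport (φ.hasCompactSupport.mul_right.smul_right)
  have hint2 : ∀ k, Integrable fun x => (φ x * deriv f (w' k x)) • H x := fun k =>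
    hH.bdd_smul (C * L)
      (φ.continuous.mul (hf'.comp (hw'd k).continuous)).aestronglyMeasurable
      (Eventually.of_forall fun x => hbd _ x)
  have hint3 : ∀ k, Integrable fun x => (φ x * deriv f (w' k x)) • (H' k x - H x) := fun k =>
    ((hint1 k).sub (hint2 k)).congr (Eventually.of_forall fun x => (smul_sub _ _ _).symm)
  have hlim2 : Tendsto (fun k => ∫ x, (φ x * deriv f (w' k x)) • (H' k x - H x)) atTop (𝓝 0) := by
    have := tendsto_integral_of_norm_sub_le (d := fun k => H' k - H) (c := C * L)
      (Ψ := fun _ => (0 : Eucl n)) (Φ := fun k x => (φ x * deriv f (w' k x)) • (H' k x - H x))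
      aestronglyMeasurable_const
      (Eventually.of_forall hint3) hHL
      fun k x => by
        rw [sub_zero, norm_smul, Real.norm_eq_abs, Pi.sub_apply]
        gcongr
        exact hbd _ x
    simpa using this
  have hlim3 : Tendsto (fun k => ∫ x, (φ x * deriv f (w' k x)) • H x) atTop
      (𝓝 (∫ x, (φ x * deriv f (W x)) • H x)) := by
    refine tendsto_integral_of_dominated_convergence (fun x => C * L * ‖H x‖)
      (fun k => (hint2 k).aestronglyMeasurable) (hH.norm.const_mul _)
      (fun k => Eventually.of_forall fun x => ?_) (hae.mono fun x hx => ?_)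
    · rw [norm_smul]
      gcongr
      exact hbd _ x
    · exact ((hf'.tendsto _).comp hx).const_mul (φ x) |>.smul_const _
  -- The gradient term is split so that each part has an evident limit: H' k - H is small in `L^1`
  -- against a bounded factor, while with H fixed the factor converges a.e. and domination applies.
  have hparts : ∀ᶠ k in atTop, ∫ x, f (w' k x) • gradient φ x
      = -((∫ x, (φ x * deriv f (w' k x)) • (H' k x - H x))
        + ∫ x, (φ x * deriv f (w' k x)) • H x) := by
    filter_upwards [(tendsto_rOut_shrinkingBump (n := n)).eventually_lt_const hδ] with k hk
    have hibp := integral_smul_gradient_eq_neg (hf.comp (hw'd k)) hφ1 φ.hasCompactSupport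
    simp only [Function.comp_apply] at hibp
    rw [hibp, ← integral_add (hint3 k) (hint2 k)]
    congr 1
    refine integral_congr_ae (Eventually.of_forall fun x => ?_)
    by_cases hx : x ∈ tsupport φ
    · have hball : Metric.closedBall x (shrinkingBump n k).rOut ⊆ K :=
        (Metric.closedBall_subset_closedBall hk.le).trans
          (Metric.closedBall_subset_cthickening hx δ)
      have hgrad : HasGradientAt (w' k) (H' k x) x :=
        h.hasGradientAt_mollify _ hW.locallyIntegrable (hball.trans hδΩ)
          (Eventually.of_forall fun y hy => Set.indicator_of_mem (hball hy) w)
          (Eventually.of_forall fun y hy => Set.indicator_of_mem (hball hy) G)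
      have hcomp : gradient (f ∘ w' k) x = deriv f (w' k x) • H' k x := by
        refine HasGradientAt.gradient ?_
        have h1 := (hfd (w' k x)).hasDerivAt.comp_hasFDerivAt x hgrad.hasFDerivAt
        rw [hasGradientAt_iff_hasFDerivAt]
        refine h1.congr_fderiv ?_
        ext e
        simp
      simp only [hcomp, ← smul_add, sub_add_cancel, mul_smul]
    · simp [TestFunction.eq_zero_of_notMem φ hx]
  have hfinal := tendsto_nhds_unique hlim1
    (((hlim2.add hlim3).neg).congr' (hparts.mono fun k hk => hk.symm))
  rw [zero_add] at hfinal
  rw [setIntegral_eq_integral_of_forall_compl_eq_zero,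
    setIntegral_eq_integral_of_forall_compl_eq_zero]
  · convert hfinal using 1
    · refine integral_congr_ae (Eventually.of_forall fun x => ?_)
      by_cases hx : x ∈ tsupport φ
      · simp only [W, Set.indicator_of_mem (hφK hx)]
      · simp only [gradient_eq_zero_of_notMem_tsupport hx, smul_zero]
    · congr 1
      refine integral_congr_ae (Eventually.of_forall fun x => ?_)
      by_cases hx : x ∈ tsupport φ
      · simp only [W, H, Set.indicator_of_mem (hφK hx), mul_smul]
      · simp only [TestFunction.eq_zero_of_notMem φ hx, zero_smul, zero_mul]
  · intro x hx
    rw [TestFunction.eq_zero_of_notMem φ fun h => hx (φ.tsupport_subset h), zero_smul]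
  · intro x hx
    rw [gradient_eq_zero_of_notMem_tsupport fun h => hx (φ.tsupport_subset h), smul_zero]

end

end QuasilinearObstacle
-- Calculus of weak gradients: linearity, limits, zero sets, positive parts.
namespace QuasilinearObstacle

noncomputable section

variable {n : ℕ} {Ω : Opens (Eucl n)} {F : Type*} [NormedAddCommGroup F]

lemma integrableOn_smul_gradient (φ : 𝓓(Ω, ℝ)) {u : Eucl n → ℝ}
    (hu : LocallyIntegrableOn u (Ω : Set (Eucl n)) volume) :
    IntegrableOn (fun x => u x • gradient φ x) (Ω : Set (Eucl n)) volume := by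
  obtain ⟨C, hC0, -, hC⟩ := TestFunction.exists_bound φ
  have h1 : IntegrableOn (fun x => u x • gradient φ x) (tsupport φ) volume := by
    refine Integrable.smul_of_top_left
      (hu.integrableOn_compact_subset φ.tsupport_subset φ.hasCompactSupport)
      (memLp_top_of_bound ?_ C (Eventually.of_forall hC))
    exact (continuous_gradient (TestFunction.contDiff_one φ)).aestronglyMeasurable
  refine h1.of_forall_sdiff_eq_zero Ω.isOpen.measurableSet fun x hx => ?_
  rw [gradient_eq_zero_of_notMem_tsupport hx.2, smul_zero]

lemma integrableOn_testFunction_smul [NormedSpace ℝ F] (φ : 𝓓(Ω, ℝ)) {G : Eucl n → F}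
    (hG : LocallyIntegrableOn G (Ω : Set (Eucl n)) volume) :
    IntegrableOn (fun x => φ x • G x) (Ω : Set (Eucl n)) volume := by
  obtain ⟨C, hC0, hC, -⟩ := TestFunction.exists_bound φ
  have h1 : IntegrableOn (fun x => φ x • G x) (tsupport φ) volume := by
    refine Integrable.bdd_smul ?_ C ?_ (Eventually.of_forall hC)
    · exact hG.integrableOn_compact_subset φ.tsupport_subset φ.hasCompactSupport
    · exact φ.continuous.aestronglyMeasurable
  refine h1.of_forall_sdiff_eq_zero Ω.isOpen.measurableSet fun x hx => ?_
  rw [TestFunction.eq_zero_of_notMem φ hx.2, zero_smul]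

namespace IsWeakGradient

variable {u v : Eucl n → ℝ} {G H : Eucl n → Eucl n}

lemma add (hu : IsWeakGradient Ω u G) (hv : IsWeakGradient Ω v H) :
    IsWeakGradient Ω (fun x => u x + v x) (fun x => G x + H x) where
  locallyIntegrableOn := hu.locallyIntegrableOn.add hv.locallyIntegrableOn
  locallyIntegrableOn_grad := hu.locallyIntegrableOn_grad.add hv.locallyIntegrableOn_grad
  integral_eq φ := by
    simp only [add_smul, smul_add]
    rw [integral_add (integrableOn_smul_gradient φ hu.locallyIntegrableOn)
      (integrableOn_smul_gradient φ hv.locallyIntegrableOn),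
      integral_add (integrableOn_testFunction_smul φ hu.locallyIntegrableOn_grad)
      (integrableOn_testFunction_smul φ hv.locallyIntegrableOn_grad),
      hu.integral_eq, hv.integral_eq, neg_add]

lemma const_mul (hu : IsWeakGradient Ω u G) (c : ℝ) :
    IsWeakGradient Ω (fun x => c * u x) (fun x => c • G x) where
  locallyIntegrableOn := hu.locallyIntegrableOn.smul c
  locallyIntegrableOn_grad := hu.locallyIntegrableOn_grad.smul c
  integral_eq φ := by
    simp only [mul_smul, smul_comm _ c]
    rw [integral_smul, integral_smul, hu.integral_eq, smul_neg]

lemma neg (hu : IsWeakGradient Ω u G) : IsWeakGradient Ω (fun x => -u x) (fun x => -G x) := by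
  simpa using hu.const_mul (-1)

lemma sub (hu : IsWeakGradient Ω u G) (hv : IsWeakGradient Ω v H) :
    IsWeakGradient Ω (fun x => u x - v x) (fun x => G x - H x) := by
  simpa only [sub_eq_add_neg] using hu.add hv.neg

lemma congr (hu : IsWeakGradient Ω u G)
    (hG : G =ᵐ[volume.restrict (Ω : Set (Eucl n))] H) : IsWeakGradient Ω u H where
  locallyIntegrableOn := hu.locallyIntegrableOn
  locallyIntegrableOn_grad := locallyIntegrableOn_of_norm_le
    (hu.locallyIntegrableOn_grad.aestronglyMeasurable.congr hG) hu.locallyIntegrableOn_grad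
    (hG.mono fun x hx => by rw [hx])
  integral_eq φ := by
    have h : (fun x => φ x • G x) =ᵐ[volume.restrict (Ω : Set (Eucl n))] fun x => φ x • H x :=
      hG.mono fun x hx => by simp only [hx]
    rw [hu.integral_eq, integral_congr_ae h]

/-- Weak gradients pass to dominated limits. -/
theorem of_tendsto {uk : ℕ → Eucl n → ℝ} {Gk : ℕ → Eucl n → Eucl n} {U V : Eucl n → ℝ}
    (hk : ∀ k, IsWeakGradient Ω (uk k) (Gk k))
    (hU : LocallyIntegrableOn U (Ω : Set (Eucl n)) volume)
    (hV : LocallyIntegrableOn V (Ω : Set (Eucl n)) volume)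
    (huU : ∀ k x, |uk k x| ≤ U x) (hGV : ∀ k x, ‖Gk k x‖ ≤ V x)
    (hu : ∀ᵐ x ∂(volume.restrict (Ω : Set (Eucl n))), Tendsto (fun k => uk k x) atTop (𝓝 (u x)))
    (hG : ∀ᵐ x ∂(volume.restrict (Ω : Set (Eucl n))), Tendsto (fun k => Gk k x) atTop (𝓝 (G x))) :
    IsWeakGradient Ω u G := by
  have hum := aestronglyMeasurable_of_tendsto_ae atTop
    (fun k => (hk k).locallyIntegrableOn.aestronglyMeasurable) hu
  have hGm := aestronglyMeasurable_of_tendsto_ae atTop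
    (fun k => (hk k).locallyIntegrableOn_grad.aestronglyMeasurable) hG
  refine ⟨?_, ?_, fun φ => ?_⟩
  · refine locallyIntegrableOn_of_norm_le hum hU (hu.mono fun x hx => ?_)
    exact (le_of_tendsto hx.norm (Eventually.of_forall fun k => huU k x)).trans (le_abs_self _)
  · refine locallyIntegrableOn_of_norm_le hGm hV (hG.mono fun x hx => ?_)
    exact (le_of_tendsto hx.norm (Eventually.of_forall fun k => hGV k x)).trans (le_abs_self _)
  have h1 : Tendsto (fun k => ∫ x in (Ω : Set (Eucl n)), uk k x • gradient φ x) atTop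
      (𝓝 (∫ x in (Ω : Set (Eucl n)), u x • gradient φ x)) := by
    refine tendsto_integral_of_dominated_convergence (fun x => ‖U x • gradient φ x‖)
      (fun k => (integrableOn_smul_gradient φ (hk k).locallyIntegrableOn).aestronglyMeasurable)
      (integrableOn_smul_gradient φ hU).norm (fun k => Eventually.of_forall fun x => ?_)
      (hu.mono fun x hx => hx.smul_const _)
    rw [norm_smul, norm_smul]
    gcongr
    exact (huU k x).trans (le_abs_self _)
  have h2 : Tendsto (fun k => ∫ x in (Ω : Set (Eucl n)), φ x • Gk k x) atTop
      (𝓝 (∫ x in (Ω : Set (Eucl n)), φ x • G x)) := by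
    refine tendsto_integral_of_dominated_convergence (fun x => ‖φ x • V x‖)
      (fun k => (integrableOn_testFunction_smul φ
        (hk k).locallyIntegrableOn_grad).aestronglyMeasurable)
      (integrableOn_testFunction_smul φ hV).norm (fun k => Eventually.of_forall fun x => ?_)
      (hG.mono fun x hx => hx.const_smul _)
    rw [norm_smul, norm_smul]
    gcongr
    exact (hGV k x).trans (le_abs_self _)
  refine tendsto_nhds_unique h1 (h2.neg.congr fun k => ?_)
  rw [(hk k).integral_eq φ]

lemma locallyIntegrableOn_abs_add (hu : IsWeakGradient Ω u G) (c : ℝ) :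
    LocallyIntegrableOn (fun x => |u x| + c) (Ω : Set (Eucl n)) volume :=
  hu.locallyIntegrableOn.norm.add (continuous_const.locallyIntegrable.locallyIntegrableOn _)

/-- The weak gradient vanishes almost everywhere on the zero set. -/
theorem ae_eq_zero_of_eq_zero (hu : IsWeakGradient Ω u G) :
    ∀ᵐ x ∂(volume.restrict (Ω : Set (Eucl n))), u x = 0 → G x = 0 := by
  -- These functions tend to 0 uniformly, while their derivatives stay in [0, 1] and tend to the
  -- indicator of {0}. In the limit the zero function gets the weak gradient `G` restricted to {u =
  -- 0}.
  set f : ℕ → ℝ → ℝ := fun k t => Real.arctan (((k : ℝ) + 1) * t) / ((k : ℝ) + 1) with hf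
  have hder : ∀ k t, HasDerivAt (f k) (1 / (1 + (((k : ℝ) + 1) * t) ^ 2)) t := by
    intro k t
    have hk : (k : ℝ) + 1 ≠ 0 := by positivity
    have h1 : HasDerivAt (fun t : ℝ => ((k : ℝ) + 1) * t) ((k : ℝ) + 1) t := by
      simpa using (hasDerivAt_id t).const_mul ((k : ℝ) + 1)
    exact ((h1.arctan).div_const ((k : ℝ) + 1)).congr_deriv (mul_div_cancel_right₀ _ hk)
  have hderiv : ∀ k t, deriv (f k) t = 1 / (1 + (((k : ℝ) + 1) * t) ^ 2) := fun k t =>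
    (hder k t).deriv
  have hb : ∀ k t, |deriv (f k) t| ≤ 1 := fun k t => by
    rw [hderiv, abs_of_nonneg (by positivity), div_le_one (by positivity)]
    nlinarith [sq_nonneg (((k : ℝ) + 1) * t)]
  have hfC : ∀ k, ContDiff ℝ 1 (f k) := fun k =>
    (Real.contDiff_arctan.comp (contDiff_const.mul contDiff_id)).div_const _
  have hfb : ∀ k t, |f k t| ≤ 2 / ((k : ℝ) + 1) := fun k t => by
    simp only [hf]
    rw [abs_div, abs_of_pos (by positivity : (0 : ℝ) < (k : ℝ) + 1)]
    gcongr
    rw [abs_le]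
    have := Real.arctan_lt_pi_div_two (((k : ℝ) + 1) * t)
    have := Real.neg_pi_div_two_lt_arctan (((k : ℝ) + 1) * t)
    have := Real.pi_le_four
    constructor <;> linarith
  have h0 : IsWeakGradient Ω (fun _ => (0 : ℝ)) ({x | u x = 0}.indicator G) := by
    refine of_tendsto (fun k => hu.comp (hfC k) (hb k)) (hu.locallyIntegrableOn_abs_add 2)
      hu.locallyIntegrableOn_grad.norm (fun k x => ?_) (fun k x => ?_)
      (Eventually.of_forall fun x => ?_) (Eventually.of_forall fun x => ?_)
    · refine (hfb k _).trans ?_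
      have : 2 / ((k : ℝ) + 1) ≤ 2 :=
        div_le_self (by norm_num) (by linarith [(Nat.cast_nonneg k : (0 : ℝ) ≤ k)])
      linarith [abs_nonneg (u x)]
    · rw [norm_smul]
      exact mul_le_of_le_one_left (norm_nonneg _) (hb k _)
    · refine squeeze_zero_norm (fun k => hfb k _) ?_
      have := (tendsto_one_div_add_atTop_nhds_zero_nat (𝕜 := ℝ)).const_mul 2
      simpa [div_eq_mul_inv] using this
    · simp only [hderiv]
      by_cases hx : u x = 0
      · rw [Set.indicator_of_mem (show x ∈ {x | u x = 0} from hx)]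
        simp [hx]
      · rw [Set.indicator_of_notMem (show x ∉ {x | u x = 0} from hx)]
        have h1 : Tendsto (fun k : ℕ => 1 + (((k : ℝ) + 1) * u x) ^ 2) atTop atTop := by
          refine tendsto_atTop_add_const_left _ _ ?_
          have h2 : Tendsto (fun k : ℕ => ((k : ℝ) + 1) ^ 2) atTop atTop :=
            (tendsto_pow_atTop two_ne_zero).comp
              (tendsto_atTop_add_const_right _ _ tendsto_natCast_atTop_atTop)
          simpa only [mul_pow] using h2.atTop_mul_const (by positivity : 0 < u x ^ 2)
        simpa using ((tendsto_const_nhds (x := (1 : ℝ))).div_atTop h1).smul_const (G x)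
  -- A weak gradient of the zero function integrates to zero against every test function, hence
  -- vanishes a.e.
  have h1 := Ω.isOpen.ae_eq_zero_of_integral_contDiff_smul_eq_zero h0.locallyIntegrableOn_grad
    fun g hg hgc hgΩ => by
      have := h0.integral_eq ⟨g, hg, hgc, hgΩ⟩
      simp only [zero_smul, integral_zero, TestFunction.coe_mk] at this
      rw [zero_eq_neg] at this
      rw [← this]
      refine (setIntegral_eq_integral_of_forall_compl_eq_zero fun x hx => ?_).symm
      rw [image_eq_zero_of_notMem_tsupport fun h => hx (hgΩ h), zero_smul]
  rw [ae_restrict_iff' Ω.isOpen.measurableSet]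
  filter_upwards [h1] with x hx hxΩ hux
  have := hx hxΩ
  rwa [Set.indicator_of_mem (show x ∈ {x | u x = 0} from hux)] at this

/-- The positive part of a weakly differentiable function. -/
theorem posPart (hu : IsWeakGradient Ω u G) :
    IsWeakGradient Ω (fun x => max (u x) 0) ({x | 0 < u x}.indicator G) := by
  set ε : ℕ → ℝ := fun k => 1 / ((k : ℝ) + 1) with hε
  have hε0 : ∀ k, 0 < ε k := fun k => by positivity
  have hε1 : ∀ k, ε k ≤ 1 := fun k =>
    div_le_self zero_le_one (by linarith [(Nat.cast_nonneg k : (0 : ℝ) ≤ k)])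
  have hεt : Tendsto ε atTop (𝓝 0) := tendsto_one_div_add_atTop_nhds_zero_nat
  have hpos : ∀ k t, 0 < t ^ 2 + ε k ^ 2 := fun k t => by have := hε0 k; positivity
  have hsq : ∀ k t, |t| ≤ √(t ^ 2 + ε k ^ 2) := fun k t => by
    rw [← Real.sqrt_sq_eq_abs]
    exact Real.sqrt_le_sqrt (by nlinarith [sq_nonneg (ε k)])
  -- Smooth approximation of t⁺ = (t + |t|) / 2 with derivatives in [0, 1].
  set f : ℕ → ℝ → ℝ := fun k t => (t + √(t ^ 2 + ε k ^ 2)) / 2 with hf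
  have hder : ∀ k t, HasDerivAt (f k) ((1 + t / √(t ^ 2 + ε k ^ 2)) / 2) t := by
    intro k t
    have h1 : HasDerivAt (fun t : ℝ => t ^ 2 + ε k ^ 2) (2 * t) t := by
      simpa using (hasDerivAt_pow 2 t).add_const (ε k ^ 2)
    refine (((hasDerivAt_id t).add (h1.sqrt (hpos k t).ne')).div_const 2).congr_deriv ?_
    rw [mul_div_mul_left _ _ two_ne_zero]
  have hderiv : ∀ k t, deriv (f k) t = (1 + t / √(t ^ 2 + ε k ^ 2)) / 2 := fun k t =>
    (hder k t).deriv
  have hb : ∀ k t, |deriv (f k) t| ≤ 1 := fun k t => by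
    have h1 : |t / √(t ^ 2 + ε k ^ 2)| ≤ 1 := by
      rw [abs_div, abs_of_nonneg (Real.sqrt_nonneg _)]
      exact div_le_one_of_le₀ (hsq k t) (Real.sqrt_nonneg _)
    rw [abs_le] at h1
    rw [hderiv, abs_le]
    constructor <;> linarith
  have hfC : ∀ k, ContDiff ℝ 1 (f k) := fun k =>
    (contDiff_id.add (((contDiff_id.pow 2).add contDiff_const).sqrt
      fun t => (hpos k t).ne')).div_const _
  have hlim : ∀ t, Tendsto (fun k => √(t ^ 2 + ε k ^ 2)) atTop (𝓝 |t|) := fun t => by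
    rw [← Real.sqrt_sq_eq_abs]
    have h1 : Tendsto (fun k => t ^ 2 + ε k ^ 2) atTop (𝓝 (t ^ 2 + 0 ^ 2)) :=
      (hεt.pow 2).const_add _
    simp only [ne_eq, OfNat.ofNat_ne_zero, not_false_eq_true, zero_pow, add_zero] at h1
    exact (Real.continuous_sqrt.tendsto _).comp h1
  refine of_tendsto (fun k => hu.comp (hfC k) (hb k)) (hu.locallyIntegrableOn_abs_add 1)
    hu.locallyIntegrableOn_grad.norm (fun k x => ?_) (fun k x => ?_)
    (Eventually.of_forall fun x => ?_) (hu.ae_eq_zero_of_eq_zero.mono fun x hx => ?_)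
  · have h1 : √(u x ^ 2 + ε k ^ 2) ≤ |u x| + 1 := by
      rw [Real.sqrt_le_left (by positivity)]
      have := hε0 k
      nlinarith [sq_abs (u x), abs_nonneg (u x), hε1 k]
    have h2 := hsq k (u x)
    simp only [hf]
    rw [abs_of_nonneg (by linarith [neg_abs_le (u x)])]
    linarith [le_abs_self (u x)]
  · rw [norm_smul]
    exact mul_le_of_le_one_left (norm_nonneg _) (hb k _)
  · have h1 := ((hlim (u x)).const_add (u x)).div_const 2
    convert h1 using 2
    rcases le_total 0 (u x) with h | h
    · rw [max_eq_left h, abs_of_nonneg h]; ring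
    · rw [max_eq_right h, abs_of_nonpos h]; ring
  · rcases eq_or_ne (u x) 0 with h0 | h0
    -- At t = 0 the approximate derivatives equal 1/2 and miss the indicator of t > 0; this is
    -- harmless because `G` vanishes a.e. on {u = 0}.
    · simp [hx h0, h0]
    · simp only [hderiv]
      have h1 : Tendsto (fun k => (1 + u x / √(u x ^ 2 + ε k ^ 2)) / 2) atTop
          (𝓝 ((1 + u x / |u x|) / 2)) :=
        ((tendsto_const_nhds.div (hlim (u x)) (abs_ne_zero.2 h0)).const_add 1).div_const 2
      convert h1.smul_const (G x) using 2
      rcases lt_or_gt_of_ne h0 with h | h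
      · rw [Set.indicator_of_notMem (show x ∉ {x | 0 < u x} from h.not_gt), abs_of_neg h,
          div_neg, div_self h0]
        simp
      · rw [Set.indicator_of_mem (show x ∈ {x | 0 < u x} from h), abs_of_pos h, div_self h0]
        norm_num

end IsWeakGradient

lemma MemLpLoc.of_norm_le {E : Type*} [NormedAddCommGroup E] {q : ℝ≥0∞} {u : Eucl n → F}
    {U : Eucl n → E} (hU : MemLpLoc Ω q U)
    (hu : AEStronglyMeasurable u (volume.restrict (Ω : Set (Eucl n))))
    (h : ∀ x, ‖u x‖ ≤ ‖U x‖) : MemLpLoc Ω q u := fun C hC hCΩ =>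
  (hU C hC hCΩ).mono (hu.mono_set hCΩ) (Eventually.of_forall h)

namespace MemW1pLocLinfLoc

variable {p : ℝ} {u v : Eucl n → ℝ} {G H : Eucl n → Eucl n}

lemma add (hu : MemW1pLocLinfLoc Ω p u G) (hv : MemW1pLocLinfLoc Ω p v H) :
    MemW1pLocLinfLoc Ω p (fun x => u x + v x) (fun x => G x + H x) where
  memW1pLoc :=
    { isWeakGradient := hu.memW1pLoc.isWeakGradient.add hv.memW1pLoc.isWeakGradient
      memLpLoc := fun C hC hCΩ => (hu.memW1pLoc.memLpLoc C hC hCΩ).add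
        (hv.memW1pLoc.memLpLoc C hC hCΩ)
      memLpLoc_grad := fun C hC hCΩ => (hu.memW1pLoc.memLpLoc_grad C hC hCΩ).add
        (hv.memW1pLoc.memLpLoc_grad C hC hCΩ) }
  memLinfLoc C hC hCΩ := (hu.memLinfLoc C hC hCΩ).add (hv.memLinfLoc C hC hCΩ)

lemma const_mul (hu : MemW1pLocLinfLoc Ω p u G) (c : ℝ) :
    MemW1pLocLinfLoc Ω p (fun x => c * u x) (fun x => c • G x) where
  memW1pLoc :=
    { isWeakGradient := hu.memW1pLoc.isWeakGradient.const_mul c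
      memLpLoc := fun C hC hCΩ => (hu.memW1pLoc.memLpLoc C hC hCΩ).const_mul c
      memLpLoc_grad := fun C hC hCΩ => (hu.memW1pLoc.memLpLoc_grad C hC hCΩ).const_smul c }
  memLinfLoc C hC hCΩ := (hu.memLinfLoc C hC hCΩ).const_mul c

lemma neg (hu : MemW1pLocLinfLoc Ω p u G) :
    MemW1pLocLinfLoc Ω p (fun x => -u x) (fun x => -G x) := by
  simpa using hu.const_mul (-1)

lemma sub (hu : MemW1pLocLinfLoc Ω p u G) (hv : MemW1pLocLinfLoc Ω p v H) :
    MemW1pLocLinfLoc Ω p (fun x => u x - v x) (fun x => G x - H x) := by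
  simpa only [sub_eq_add_neg] using hu.add hv.neg

lemma posPart (hu : MemW1pLocLinfLoc Ω p u G) :
    MemW1pLocLinfLoc Ω p (fun x => max (u x) 0) ({x | 0 < u x}.indicator G) := by
  have hw := hu.memW1pLoc.isWeakGradient.posPart
  have hle : ∀ x, ‖max (u x) 0‖ ≤ ‖u x‖ := fun x => by
    rw [Real.norm_of_nonneg (le_max_right _ _)]
    exact max_le (le_abs_self _) (norm_nonneg _)
  exact ⟨⟨hw, hu.memW1pLoc.memLpLoc.of_norm_le hw.locallyIntegrableOn.aestronglyMeasurable hle,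
    hu.memW1pLoc.memLpLoc_grad.of_norm_le hw.locallyIntegrableOn_grad.aestronglyMeasurable
      fun x => norm_indicator_le_norm_self _ _⟩,
    hu.memLinfLoc.of_norm_le hw.locallyIntegrableOn.aestronglyMeasurable hle⟩

end MemW1pLocLinfLoc

end

end QuasilinearObstacle
-- Measurability and local integrability of the coefficients along a function.
namespace QuasilinearObstacle

noncomputable section

variable {n : ℕ} {Ω : Opens (Eucl n)} {F : Type*} [NormedAddCommGroup F]

/-- The superposition of a Carathéodory function with measurable functions is measurable. -/
theorem IsCaratheodoryFun.aestronglyMeasurable_comp {f : Eucl n → ℝ → Eucl n → F}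
    (hf : IsCaratheodoryFun Ω f) {u : Eucl n → ℝ} {G : Eucl n → Eucl n}
    (hu : AEStronglyMeasurable u (volume.restrict (Ω : Set (Eucl n))))
    (hG : AEStronglyMeasurable G (volume.restrict (Ω : Set (Eucl n)))) :
    AEStronglyMeasurable (fun x => f x (u x) (G x)) (volume.restrict (Ω : Set (Eucl n))) := by
  have hq := hu.prodMk hG
  set q := hq.mk _
  have hqs : StronglyMeasurable q := hq.stronglyMeasurable_mk
  refine aestronglyMeasurable_of_tendsto_ae atTop
    (f := fun k x => f x (hqs.approx k x).1 (hqs.approx k x).2) (fun k => ?_) ?_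
  · set s := hqs.approx k
    -- Along a simple function the superposition is a finite sum of f(·, s, ξ) with frozen
    -- arguments, cut off to the fibres. Continuity in (s, ξ) is needed only for the passage to the
    -- limit.
    have hsum : (fun x => f x (s x).1 (s x).2)
        = fun x => ∑ y ∈ s.range, (s ⁻¹' {y}).indicator (fun x => f x y.1 y.2) x := by
      funext x
      rw [Finset.sum_eq_single (s x) (fun y _ hy => ?_) (fun h => ?_)]
      · rw [Set.indicator_of_mem (by simp)]
      · exact Set.indicator_of_notMem (fun h => hy (by simpa using h.symm)) _
      · exact absurd (s.mem_range_self x) h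
    rw [hsum]
    exact Finset.aestronglyMeasurable_fun_sum _ fun y _ =>
      (hf.aestronglyMeasurable y.1 y.2).indicator (s.measurableSet_fiber y)
  · filter_upwards [hf.continuous, hq.ae_eq_mk] with x hx hxq
    have h1 := (hx.tendsto (q x)).comp (hqs.tendsto_approx x)
    have h2 : (u x, G x) = q x := hxq
    rw [← h2] at h1
    exact h1

lemma holderTriple_conjExponent {p : ℝ} (hp : 1 < p) :
    ENNReal.HolderTriple (ENNReal.ofReal p.conjExponent) (ENNReal.ofReal p) 1 :=
  (Real.HolderConjugate.conjExponent hp).symm.ennrealOfReal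

section Growth

variable {p : ℝ} {a : Eucl n → ℝ → Eucl n → Eucl n} {b : Eucl n → ℝ → Eucl n → ℝ}
  {w : Eucl n → ℝ} {G : Eucl n → Eucl n}

lemma LocalNaturalGrowth.exists_ae_bound (hgrowth : LocalNaturalGrowth Ω p a b)
    (hw : MemLpLoc Ω ∞ w) {C : Set (Eucl n)} (hC : IsCompact C) (hCΩ : C ⊆ Ω) :
    ∃ (α₀ α₁ : Eucl n → ℝ) (β : ℝ),
      MemLp α₀ 1 (volume.restrict C) ∧
      MemLp α₁ (ENNReal.ofReal p.conjExponent) (volume.restrict C) ∧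
      ∀ᵐ x ∂(volume.restrict C), ‖a x (w x) (G x)‖ ≤ α₁ x + β * ‖G x‖ ^ (p - 1) ∧
        |b x (w x) (G x)| ≤ α₀ x + β * ‖G x‖ ^ p := by
  -- An essential bound for `w` on C; the added 1 makes it positive.
  set R := lpNorm w ∞ (volume.restrict C) + 1
  have hR : 0 < R := add_pos_of_nonneg_of_pos lpNorm_nonneg one_pos
  obtain ⟨α₀, α₁, β, h₀, h₁, -, h⟩ := hgrowth C hC hCΩ R hR
  refine ⟨α₀, α₁, β, h₀, h₁, ?_⟩
  filter_upwards [h, ae_le_lpNorm_exponent_top (hw C hC hCΩ)] with x hx hwx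
  exact hx _ _ (hwx.trans (by simp [R]))

/-- Since |G| is locally in `L^p`, its power p - 1 is locally in `L^(p/(p-1))`, which is the
conjugate exponent. -/
lemma memLpLoc_flux (hp : 1 < p) (ha : IsCaratheodoryFun Ω a)
    (hgrowth : LocalNaturalGrowth Ω p a b) (hw : MemW1pLocLinfLoc Ω p w G) :
    MemLpLoc Ω (ENNReal.ofReal p.conjExponent) (fun x => a x (w x) (G x)) := by
  intro C hC hCΩ
  obtain ⟨α₀, α₁, β, h₀, h₁, h⟩ :=
    hgrowth.exists_ae_bound (G := G) hw.memLinfLoc hC hCΩ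
  have hm := ha.aestronglyMeasurable_comp
    hw.memW1pLoc.isWeakGradient.locallyIntegrableOn.aestronglyMeasurable
    hw.memW1pLoc.isWeakGradient.locallyIntegrableOn_grad.aestronglyMeasurable
  have hp1 : 0 < p - 1 := by linarith
  have hG := (hw.memW1pLoc.memLpLoc_grad C hC hCΩ).norm_rpow_div (ENNReal.ofReal (p - 1))
  rw [ENNReal.toReal_ofReal hp1.le, ← ENNReal.ofReal_div_of_pos hp1] at hG
  refine (h₁.add (hG.const_mul β)).mono (hm.mono_set hCΩ) (h.mono fun x hx => ?_)
  exact hx.1.trans (le_abs_self _)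

lemma memLpLoc_source (hp : 1 < p) (hb : IsCaratheodoryFun Ω b)
    (hgrowth : LocalNaturalGrowth Ω p a b) (hw : MemW1pLocLinfLoc Ω p w G) :
    MemLpLoc Ω 1 (fun x => b x (w x) (G x)) := by
  intro C hC hCΩ
  obtain ⟨α₀, α₁, β, h₀, h₁, h⟩ :=
    hgrowth.exists_ae_bound (G := G) hw.memLinfLoc hC hCΩ
  have hm := hb.aestronglyMeasurable_comp
    hw.memW1pLoc.isWeakGradient.locallyIntegrableOn.aestronglyMeasurable
    hw.memW1pLoc.isWeakGradient.locallyIntegrableOn_grad.aestronglyMeasurable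
  have hp0 : 0 < p := by linarith
  have hG := (hw.memW1pLoc.memLpLoc_grad C hC hCΩ).norm_rpow (by simpa using hp0)
    ENNReal.ofReal_ne_top
  rw [ENNReal.toReal_ofReal hp0.le] at hG
  refine (h₀.add (hG.const_mul β)).mono (hm.mono_set hCΩ) (h.mono fun x hx => ?_)
  exact hx.2.trans (le_abs_self _)

end Growth

/-! ### Compactly supported Sobolev functions as test functions. -/

section Support

variable {p : ℝ} {z : Eucl n → ℝ} {G : Eucl n → Eucl n}

/-- A compactly supported function and its weak gradient vanish outside a compact set. -/
lemma MemLinfC.exists_compact (hz : MemLinfC Ω z) (hG : IsWeakGradient Ω z G) :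
    ∃ C : Set (Eucl n), IsCompact C ∧ C ⊆ Ω ∧
      ∀ᵐ x ∂(volume.restrict (Ω : Set (Eucl n))), x ∉ C → z x = 0 ∧ G x = 0 := by
  obtain ⟨-, C, hC, hCΩ, h⟩ := hz
  refine ⟨C, hC, hCΩ, ?_⟩
  filter_upwards [h, hG.ae_eq_zero_of_eq_zero] with x hx hGx hxC
  exact ⟨hx hxC, hGx (hx hxC)⟩

lemma integrableOn_of_compact {C : Set (Eucl n)} (hCΩ : C ⊆ Ω)
    {g : Eucl n → ℝ} (hg : IntegrableOn g C volume)
    (h0 : ∀ᵐ x ∂(volume.restrict (Ω : Set (Eucl n))), x ∉ C → g x = 0) :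
    IntegrableOn g (Ω : Set (Eucl n)) volume ∧
      ∫ x in (Ω : Set (Eucl n)), g x = ∫ x in C, g x := by
  rw [ae_restrict_iff' Ω.isOpen.measurableSet] at h0
  have h1 : ∀ᵐ x, x ∈ (Ω : Set (Eucl n)) \ C → g x = 0 := h0.mono fun x hx h => hx h.1 h.2
  exact ⟨hg.of_ae_sdiff_eq_zero Ω.isOpen.measurableSet.nullMeasurableSet h1,
    setIntegral_eq_of_subset_of_ae_sdiff_eq_zero Ω.isOpen.measurableSet.nullMeasurableSet hCΩ h1⟩

lemma integrableOn_pairing (hp : 1 < p) {A : Eucl n → Eucl n} {B : Eucl n → ℝ}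
    (hA : MemLpLoc Ω (ENNReal.ofReal p.conjExponent) A) (hB : MemLpLoc Ω 1 B)
    (hz : MemLpLoc Ω ∞ z) (hG : MemLpLoc Ω (ENNReal.ofReal p) G)
    {C : Set (Eucl n)} (hC : IsCompact C) (hCΩ : C ⊆ Ω) :
    IntegrableOn (fun x => inner ℝ (A x) (G x)) C volume ∧
      IntegrableOn (fun x => B x * z x) C volume := by
  have := holderTriple_conjExponent hp
  constructor
  · refine memLp_one_iff_integrable.1 ?_
    exact MemLp.of_bilin (r := 1) (fun v w : Eucl n => inner ℝ v w) 1 (hA C hC hCΩ) (hG C hC hCΩ)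
      ((hA C hC hCΩ).1.inner (hG C hC hCΩ).1)
      (Eventually.of_forall fun x => by rw [one_mul]; exact nnnorm_inner_le_nnnorm (A x) (G x))
  · exact (memLp_one_iff_integrable.1 (hB C hC hCΩ)).mul_of_top_left (hz C hC hCΩ)

lemma integrableOn_pairing_of_memLinfC (hp : 1 < p) {A : Eucl n → Eucl n} {B : Eucl n → ℝ}
    (hA : MemLpLoc Ω (ENNReal.ofReal p.conjExponent) A) (hB : MemLpLoc Ω 1 B)
    (hz : MemW1pLocLinfLoc Ω p z G) (hzc : MemLinfC Ω z) :
    IntegrableOn (fun x => inner ℝ (A x) (G x) + B x * z x) (Ω : Set (Eucl n)) volume := by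
  obtain ⟨C, hC, hCΩ, h0⟩ := hzc.exists_compact hz.memW1pLoc.isWeakGradient
  obtain ⟨h1, h2⟩ := integrableOn_pairing hp hA hB hz.memLinfLoc hz.memW1pLoc.memLpLoc_grad hC hCΩ
  refine (integrableOn_of_compact hCΩ (h1.add h2) (h0.mono fun x hx hxC => ?_)).1
  simp [hx hxC]

end Support

lemma mollify_eq_zero_of_notMem_cthickening [NormedSpace ℝ F] (ρ : ContDiffBump (0 : Eucl n))
    {C : Set (Eucl n)} (f : Eucl n → F) {x : Eucl n} (hx : x ∉ Metric.cthickening ρ.rOut C) :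
    mollify ρ (C.indicator f) x = 0 := by
  rw [mollify_apply_swap]
  refine integral_eq_zero_of_ae (Eventually.of_forall fun y => ?_)
  by_cases hy : y ∈ C
  · have hyx : y ∉ Metric.closedBall x ρ.rOut := fun h =>
      hx (Metric.mem_cthickening_of_dist_le x y _ _ hy (by rwa [dist_comm]))
    simp [normed_sub_eq_zero_of_notMem ρ hyx]
  · simp [hy]

lemma abs_mollify_le (ρ : ContDiffBump (0 : Eucl n)) {f : Eucl n → ℝ} {M : ℝ}
    (hf : ∀ᵐ x, |f x| ≤ M) (x : Eucl n) : |mollify ρ f x| ≤ M := by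
  rw [mollify_apply_swap, ← Real.norm_eq_abs]
  have hint : Integrable fun y => ρ.normed volume (x - y) * M :=
    (ρ.integrable_normed.comp_sub_left x).mul_const M
  refine (norm_integral_le_of_norm_le hint (hf.mono fun y hy => ?_)).trans ?_
  · rw [norm_smul, Real.norm_of_nonneg (ρ.nonneg_normed _)]
    exact mul_le_mul_of_nonneg_left hy (ρ.nonneg_normed _)
  · rw [integral_mul_const, integral_sub_left_eq_self (fun y => ρ.normed volume y),
      ρ.integral_normed, one_mul]

lemma mollify_nonneg (ρ : ContDiffBump (0 : Eucl n)) {f : Eucl n → ℝ}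
    (hf : ∀ᵐ x, 0 ≤ f x) (x : Eucl n) : 0 ≤ mollify ρ f x := by
  rw [mollify_apply_swap]
  exact integral_nonneg_of_ae (hf.mono fun y hy => mul_nonneg (ρ.nonneg_normed _) hy)

/-- An inequality that holds for nonnegative smooth test functions extends to nonnegative bounded
compactly supported Sobolev test functions. -/
theorem integral_pairing_nonneg {p : ℝ} (hp : 1 < p) {A : Eucl n → Eucl n} {B : Eucl n → ℝ}
    (hA : MemLpLoc Ω (ENNReal.ofReal p.conjExponent) A) (hB : MemLpLoc Ω 1 B)
    (hpos : ∀ φ : 𝓓(Ω, ℝ), (∀ x, 0 ≤ φ x) →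
      0 ≤ ∫ x in (Ω : Set (Eucl n)), (inner ℝ (A x) (gradient φ x) + B x * φ x))
    {z : Eucl n → ℝ} {G : Eucl n → Eucl n} (hz : MemW1pLocLinfLoc Ω p z G) (hzc : MemLinfC Ω z)
    (hz0 : ∀ᵐ x ∂(volume.restrict (Ω : Set (Eucl n))), 0 ≤ z x) :
    0 ≤ ∫ x in (Ω : Set (Eucl n)), (inner ℝ (A x) (G x) + B x * z x) := by
  have hHolder := holderTriple_conjExponent hp
  have hw := hz.memW1pLoc.isWeakGradient
  obtain ⟨C, hC, hCΩ, h0⟩ := hzc.exists_compact hw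
  obtain ⟨δ, hδ, hδΩ⟩ := hC.exists_cthickening_subset_open Ω.isOpen hCΩ
  set D := Metric.cthickening δ C
  have hD : IsCompact D := hC.cthickening
  have hCD : C ⊆ D := Metric.self_subset_cthickening _
  have hΩm := Ω.isOpen.measurableSet
  set Z := C.indicator z
  set Y := C.indicator G
  have hZz : ∀ᵐ x ∂(volume.restrict (Ω : Set (Eucl n))), Z x = z x := by
    filter_upwards [h0] with x hx
    by_cases hxC : x ∈ C
    · simp [Z, hxC]
    · simp [Z, hxC, (hx hxC).1]
  have hYG : ∀ᵐ x ∂(volume.restrict (Ω : Set (Eucl n))), Y x = G x := by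
    filter_upwards [h0] with x hx
    by_cases hxC : x ∈ C
    · simp [Y, hxC]
    · simp [Y, hxC, (hx hxC).2]
  have hZi : Integrable Z :=
    (hw.locallyIntegrableOn.integrableOn_compact_subset hCΩ hC).integrable_indicator
      hC.measurableSet
  have hYp : MemLp Y (ENNReal.ofReal p) volume :=
    (memLp_indicator_iff_restrict hC.measurableSet).2 (hz.memW1pLoc.memLpLoc_grad C hC hCΩ)
  obtain ⟨M, hM⟩ : ∃ M, ∀ᵐ x, |Z x| ≤ M := by
    have hZtop : MemLp Z ∞ volume :=
      (memLp_indicator_iff_restrict hC.measurableSet).2 (hz.memLinfLoc C hC hCΩ)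
    exact ⟨_, ae_le_lpNorm_exponent_top hZtop⟩
  have hZ0 : ∀ᵐ x, 0 ≤ Z x := by
    rw [ae_restrict_iff' hΩm] at hz0
    filter_upwards [hz0] with x hx
    exact Set.indicator_apply_nonneg fun hxC => hx (hCΩ hxC)
  set Zk := fun k => mollify (shrinkingBump n k) Z
  set Yk := fun k => mollify (shrinkingBump n k) Y
  have hYloc := hYp.locallyIntegrable (by simpa using hp.le)
  have hZkc : ∀ k, Continuous (Zk k) := fun k =>
    (contDiff_mollify (m := 0) _ hZi.locallyIntegrable).continuous
  have hYkc : ∀ k, Continuous (Yk k) := fun k =>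
    (contDiff_mollify (m := 0) _ hYloc).continuous
  have hYkp : ∀ k, MemLp (Yk k) (ENNReal.ofReal p) volume := fun k =>
    ⟨(hYkc k).aestronglyMeasurable,
      (eLpNorm_mollify_le _ hYp.1 hp.le).trans_lt hYp.2⟩
  have hAD := hA D hD hδΩ
  have hBD := memLp_one_iff_integrable.1 (hB D hD hδΩ)
  have hinner : ∀ g : Eucl n → Eucl n, MemLp g (ENNReal.ofReal p) volume →
      IntegrableOn (fun x => inner ℝ (A x) (g x)) D volume := fun g hg =>
    memLp_one_iff_integrable.1 <|
      MemLp.of_bilin (r := 1) (fun v w : Eucl n => inner ℝ v w) 1 hAD (hg.restrict D)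
        (hAD.1.inner (hg.restrict D).1)
        (Eventually.of_forall fun x => by rw [one_mul]; exact nnnorm_inner_le_nnnorm (A x) (g x))
  have hBZk : ∀ k, IntegrableOn (fun x => B x * Zk k x) D volume := fun k =>
    hBD.mul_bdd (c := M) (hZkc k).aestronglyMeasurable (Eventually.of_forall (abs_mollify_le _ hM))
  have hBZ : IntegrableOn (fun x => B x * Z x) D volume :=
    hBD.mul_bdd (c := M) hZi.1.restrict (ae_restrict_of_ae hM)
  -- Hölder's inequality, using that the mollified gradients converge in `L^p`.
  have hlim1 : Tendsto (fun k => ∫ x in D, inner ℝ (A x) (Yk k x)) atTop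
      (𝓝 (∫ x in D, inner ℝ (A x) (Y x))) := by
    refine tendsto_integral_of_L1' _ (hinner Y hYp).1
      (Eventually.of_forall fun k => hinner _ (hYkp k)) ?_
    have hle : ∀ k, eLpNorm ((fun x => inner ℝ (A x) (Yk k x)) - fun x => inner ℝ (A x) (Y x)) 1
        (volume.restrict D) ≤ eLpNorm A (ENNReal.ofReal p.conjExponent) (volume.restrict D)
          * eLpNorm (Yk k - Y) (ENNReal.ofReal p) volume := fun k => by
      have h1 := eLpNorm_le_eLpNorm_mul_eLpNorm'_of_norm (p := ENNReal.ofReal p.conjExponent)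
        (q := ENNReal.ofReal p) (r := 1) hAD.1
        ((hYkp k).sub hYp |>.restrict D).1 (fun v w : Eucl n => inner ℝ v w) 1
        (Eventually.of_forall fun x => by simpa using abs_real_inner_le_norm (A x) ((Yk k - Y) x))
      have h2 : ((fun x => inner ℝ (A x) (Yk k x)) - fun x => inner ℝ (A x) (Y x))
          = fun x => inner ℝ (A x) ((Yk k - Y) x) := by
        funext x
        simp [inner_sub_right]
      rw [h2]
      refine h1.trans ?_
      rw [ENNReal.coe_one, one_mul]
      gcongr
      exact Measure.restrict_le_self
    refine tendsto_of_tendsto_of_tendsto_of_le_of_le tendsto_const_nhds ?_ (fun _ => zero_le) hle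
    simpa using ENNReal.Tendsto.const_mul (tendsto_eLpNorm_mollify_sub hp.le hYp)
      (Or.inr hAD.2.ne)
  -- As `B` is merely integrable, norm convergence of the mollifications is of no use here; their
  -- uniform bound M and a.e. convergence give domination.
  have hlim2 : Tendsto (fun k => ∫ x in D, B x * Zk k x) atTop (𝓝 (∫ x in D, B x * Z x)) := by
    refine tendsto_integral_of_dominated_convergence (fun x => ‖B x‖ * M)
      (fun k => (hBZk k).1) (hBD.norm.mul_const M) (fun k => Eventually.of_forall fun x => ?_)
      (ae_restrict_of_ae ((ae_tendsto_mollify hZi.locallyIntegrable).mono fun x hx =>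
        hx.const_mul _))
    rw [norm_mul]
    exact mul_le_mul_of_nonneg_left (abs_mollify_le _ hM x) (norm_nonneg _)
  have hnonneg : ∀ᶠ k in atTop,
      0 ≤ (∫ x in D, inner ℝ (A x) (Yk k x)) + ∫ x in D, B x * Zk k x := by
    -- Half of δ, because the gradient identity is needed at points within one radius of C and there
    -- uses a ball of one more radius, all of which must lie in Ω.
    filter_upwards [(tendsto_rOut_shrinkingBump (n := n)).eventually_lt_const (half_pos hδ)]
      with k hk
    set ρ := shrinkingBump n k
    have hρ := ρ.rOut_pos
    have hsub : Metric.cthickening ρ.rOut C ⊆ D := Metric.cthickening_mono (by linarith) C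
    have htsupp : tsupport (Zk k) ⊆ Metric.cthickening ρ.rOut C :=
      closure_minimal (fun x hx => by_contra fun h =>
        hx (mollify_eq_zero_of_notMem_cthickening ρ z h)) Metric.isClosed_cthickening
    let φ : 𝓓(Ω, ℝ) :=
      { toFun := Zk k
        contDiff' := contDiff_mollify _ hZi.locallyIntegrable
        hasCompactSupport' := HasCompactSupport.of_support_subset_isCompact hC.cthickening
          ((subset_tsupport _).trans htsupp)
        tsupport_subset' := htsupp.trans (hsub.trans hδΩ) }
    have hgrad : ∀ x, gradient (Zk k) x = Yk k x := by
      intro x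
      by_cases hx : x ∈ Metric.cthickening ρ.rOut C
      · have hball : Metric.closedBall x ρ.rOut ⊆ Ω := by
          refine Set.Subset.trans ?_ hδΩ
          refine (Metric.closedBall_subset_cthickening hx ρ.rOut).trans ?_
          refine (Metric.cthickening_cthickening_subset hρ.le hρ.le C).trans ?_
          exact Metric.cthickening_mono (by linarith) C
        rw [ae_restrict_iff' hΩm] at hZz hYG
        exact (hw.hasGradientAt_mollify ρ hZi.locallyIntegrable hball
          (hZz.mono fun y hy h => hy (hball h)) (hYG.mono fun y hy h => hy (hball h))).gradient
      · rw [gradient_eq_zero_of_notMem_tsupport fun h => hx (htsupp h)]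
        exact (mollify_eq_zero_of_notMem_cthickening ρ G hx).symm
    have h1 := hpos φ fun x => mollify_nonneg ρ hZ0 x
    have h2 : ∀ x, x ∉ D → inner ℝ (A x) (gradient φ x) + B x * φ x = 0 := fun x hx => by
      have hx1 : x ∉ tsupport φ := fun h => hx (hsub (htsupp h))
      rw [gradient_eq_zero_of_notMem_tsupport hx1, TestFunction.eq_zero_of_notMem φ hx1]
      simp
    have h3 : (fun x => inner ℝ (A x) (gradient φ x) + B x * φ x)
        = fun x => inner ℝ (A x) (Yk k x) + B x * Zk k x := by
      funext x
      rw [← hgrad x]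
      rfl
    rw [setIntegral_eq_of_subset_of_forall_sdiff_eq_zero hΩm hδΩ fun x hx => h2 x hx.2, h3,
      integral_add (hinner _ (hYkp k)) (hBZk k)] at h1
    exact h1
  have hfinal := ge_of_tendsto (hlim1.add hlim2) hnonneg
  rw [← integral_add (hinner Y hYp) hBZ] at hfinal
  refine hfinal.trans_eq ?_
  have h4 : ∫ x in (Ω : Set (Eucl n)), (inner ℝ (A x) (G x) + B x * z x)
      = ∫ x in (Ω : Set (Eucl n)), (inner ℝ (A x) (Y x) + B x * Z x) := by
    refine integral_congr_ae ?_
    filter_upwards [hZz, hYG] with x hx hx'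
    rw [hx, hx']
  rw [h4]
  refine (setIntegral_eq_of_subset_of_forall_sdiff_eq_zero hΩm hδΩ fun x hx => ?_).symm
  have hxC : x ∉ C := fun h => hx.2 (hCD h)
  simp [Z, Y, hxC]

end

end QuasilinearObstacle
-- The truncation estimate at an upper obstacle.
namespace QuasilinearObstacle

noncomputable section

variable {n : ℕ} {Ω : Opens (Eucl n)} {p : ℝ}
  {a : Eucl n → ℝ → Eucl n → Eucl n} {b : Eucl n → ℝ → Eucl n → ℝ}

lemma MemLinfC.of_abs_le {v z : Eucl n → ℝ} (hv : MemLinfC Ω v)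
    (hz : AEStronglyMeasurable z (volume.restrict (Ω : Set (Eucl n)))) {c : ℝ}
    (h : ∀ᵐ x ∂(volume.restrict (Ω : Set (Eucl n))), |z x| ≤ c * |v x|) : MemLinfC Ω z := by
  obtain ⟨hv1, C, hC, hCΩ, h0⟩ := hv
  refine ⟨(hv1.norm.const_mul c).mono hz (h.mono fun x hx => hx.trans (le_abs_self _)),
    C, hC, hCΩ, ?_⟩
  filter_upwards [h, h0] with x hx hx0 hxC
  rw [hx0 hxC, abs_zero, mul_zero] at hx
  exact abs_nonpos_iff.1 hx

lemma MemW1pZero.memW1pLocLinfLoc {v : Eucl n → ℝ} {G : Eucl n → Eucl n}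
    (hv : MemW1pZero Ω p v G) (hvc : MemLinfC Ω v) : MemW1pLocLinfLoc Ω p v G where
  memW1pLoc :=
    { isWeakGradient := hv.isWeakGradient
      memLpLoc := fun _ _ hCΩ => hv.memLp.mono_measure (Measure.restrict_mono_set _ hCΩ)
      memLpLoc_grad := fun _ _ hCΩ => hv.memLp_grad.mono_measure (Measure.restrict_mono_set _ hCΩ) }
  memLinfLoc _ _ hCΩ := hvc.1.mono_measure (Measure.restrict_mono_set _ hCΩ)

/-- The condition on `a` near an upper obstacle `hi`. -/
def LipschitzBelow (Ω : Opens (Eucl n)) (p : ℝ) (a : Eucl n → ℝ → Eucl n → Eucl n)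
    (hi : Eucl n → ℝ) (Ghi : Eucl n → Eucl n) : Prop :=
  ∀ C : Set (Eucl n), IsCompact C → C ⊆ Ω → ∃ (r : ℝ) (γ : Eucl n → ℝ), 0 < r ∧
    MemLp γ (ENNReal.ofReal p.conjExponent) (volume.restrict C) ∧
    ∀ᵐ x ∂(volume.restrict C), ∀ σ : ℝ, hi x - r ≤ σ → σ ≤ hi x →
      ‖a x (hi x) (Ghi x) - a x σ (Ghi x)‖ ≤ γ x * (hi x - σ)

/-- Pointwise estimate behind the comparison with an upper obstacle. -/
lemma truncation_pointwise_bound {A₁ A₂ A₃ ξ η ζ : Eucl n} {β₁ β₂ s h v ε γ : ℝ}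
    (hε : 0 < ε) (hsh : s < h) (hpos : 0 < s + ε * v - h)
    (hmono : 0 ≤ inner ℝ (A₁ - A₃) (ξ - η)) (hlip : ‖A₂ - A₃‖ ≤ γ * (h - s)) :
    -(ε * (|γ| * |v| * ‖ξ - η‖ + ‖A₁ - A₂‖ * ‖ζ‖ + |β₁ - β₂| * |v|))
      ≤ inner ℝ A₁ (ξ + ε • ζ - η) + β₁ * (s + ε * v - h)
        - (inner ℝ A₂ (ξ + ε • ζ - η) + β₂ * (s + ε * v - h)) := by
  -- In the application A₁ = a(x, u, ∇u), A₂ = a(x, hi, ∇hi) and A₃ = a(x, u, ∇hi): the first term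
  -- is nonnegative by monotonicity, the second is controlled by the Lipschitz condition.
  have hsplit : inner ℝ A₁ (ξ + ε • ζ - η) - inner ℝ A₂ (ξ + ε • ζ - η)
      = inner ℝ (A₁ - A₃) (ξ - η) + inner ℝ (A₃ - A₂) (ξ - η) + ε * inner ℝ (A₁ - A₂) ζ := by
    simp only [inner_sub_left, inner_sub_right, inner_add_right, inner_smul_right]
    ring
  have hv : 0 < v := by
    by_contra hv
    nlinarith
  have hvabs : |v| = v := abs_of_pos hv
  have h1 : -(ε * (|γ| * v * ‖ξ - η‖)) ≤ inner ℝ (A₃ - A₂) (ξ - η) := by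
    have h2 := (abs_le.1 (abs_real_inner_le_norm (A₃ - A₂) (ξ - η))).1
    have h3 : ‖A₃ - A₂‖ ≤ |γ| * (ε * v) := by
      rw [norm_sub_rev]
      refine hlip.trans (mul_le_mul (le_abs_self _) (by linarith) (by linarith) (abs_nonneg _))
    have h4 := mul_le_mul_of_nonneg_right h3 (norm_nonneg (ξ - η))
    linarith
  have h2 : -(ε * (‖A₁ - A₂‖ * ‖ζ‖)) ≤ ε * inner ℝ (A₁ - A₂) ζ := by
    rw [← mul_neg]
    exact mul_le_mul_of_nonneg_left (abs_le.1 (abs_real_inner_le_norm _ _)).1 hε.le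
  have h3 : -(ε * (|β₁ - β₂| * v)) ≤ (β₁ - β₂) * (s + ε * v - h) := by
    have h4 : |β₁ - β₂| * (s + ε * v - h) ≤ |β₁ - β₂| * (ε * v) :=
      mul_le_mul_of_nonneg_left (by linarith) (abs_nonneg _)
    have h5 := mul_le_mul_of_nonneg_right (neg_abs_le (β₁ - β₂)) hpos.le
    linarith
  rw [hvabs]
  linarith

/-- Testing at the truncation above a supersolution costs only `o(ε)`. -/
theorem weakForm_truncation_lower_bound (hp : 1 < p)
    (ha : IsCaratheodoryFun Ω a) (hb : IsCaratheodoryFun Ω b)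
    (hgrowth : LocalNaturalGrowth Ω p a b) (hmono : MonotoneInGradient Ω a)
    {u hi v : Eucl n → ℝ} {Gu Ghi Gv : Eucl n → Eucl n}
    (hu : MemW1pLocLinfLoc Ω p u Gu) (hhi : IsSupersolution Ω p a b hi Ghi)
    (hle : ∀ᵐ x ∂(volume.restrict (Ω : Set (Eucl n))), u x ≤ hi x)
    (hlip : LipschitzBelow Ω p a hi Ghi)
    (hv : MemW1pLocLinfLoc Ω p v Gv) (hvc : MemLinfC Ω v) :
    ∃ e : ℝ → ℝ, Tendsto e (𝓝[>] 0) (𝓝 0) ∧ ∀ᶠ ε in 𝓝[>] (0 : ℝ),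
      MemW1pLocLinfLoc Ω p (fun x => max (u x + ε * v x - hi x) 0)
        ({x | 0 < u x + ε * v x - hi x}.indicator fun x => Gu x + ε • Gv x - Ghi x) ∧
      MemLinfC Ω (fun x => max (u x + ε * v x - hi x) 0) ∧
      -(ε * e ε) ≤ weakForm Ω a b u Gu (fun x => max (u x + ε * v x - hi x) 0)
        ({x | 0 < u x + ε * v x - hi x}.indicator fun x => Gu x + ε • Gv x - Ghi x) := by
  obtain ⟨C, hC, hCΩ, hv0⟩ := hvc.exists_compact hv.memW1pLoc.isWeakGradient
  obtain ⟨r, γ, hr, hγ, hlipC⟩ := hlip C hC hCΩ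
  set M := lpNorm v ∞ (volume.restrict (Ω : Set (Eucl n)))
  have hM : ∀ᵐ x ∂(volume.restrict (Ω : Set (Eucl n))), |v x| ≤ M := ae_le_lpNorm_exponent_top hvc.1
  set Au := fun x => a x (u x) (Gu x)
  set Bu := fun x => b x (u x) (Gu x)
  set Ah := fun x => a x (hi x) (Ghi x)
  set Bh := fun x => b x (hi x) (Ghi x)
  have hAu : MemLpLoc Ω _ Au := memLpLoc_flux hp ha hgrowth hu
  have hBu : MemLpLoc Ω _ Bu := memLpLoc_source hp hb hgrowth hu
  have hAh : MemLpLoc Ω _ Ah := memLpLoc_flux hp ha hgrowth hhi.mem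
  have hBh : MemLpLoc Ω _ Bh := memLpLoc_source hp hb hgrowth hhi.mem
  have hd := hu.sub hhi.mem
  -- The integrable majorant, independent of ε, of the error per unit ε; it vanishes a.e. outside C.
  set H : Eucl n → ℝ := fun x =>
    |γ x| * |v x| * ‖Gu x - Ghi x‖ + ‖Au x - Ah x‖ * ‖Gv x‖ + |Bu x - Bh x| * |v x|
  have hH0 : ∀ x, 0 ≤ H x := fun x => by positivity
  have hHint : IntegrableOn H (Ω : Set (Eucl n)) volume := by
    refine (integrableOn_of_compact hCΩ ?_ (hv0.mono fun x hx hxC => ?_)).1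
    · have := holderTriple_conjExponent hp
      have hvC := (hv.memLinfLoc C hC hCΩ).norm
      have hγv : IntegrableOn (fun x => |γ x| * ‖Gu x - Ghi x‖ * |v x|) C volume :=
        (hγ.norm.integrable_mul (hd.memW1pLoc.memLpLoc_grad C hC hCΩ).norm).mul_of_top_left hvC
      refine ((hγv.congr (ae_of_all _ fun x => mul_right_comm _ _ _)).add ?_).add ?_
      · exact ((hAu C hC hCΩ).sub (hAh C hC hCΩ)).norm.integrable_mul
          (hv.memW1pLoc.memLpLoc_grad C hC hCΩ).norm
      · exact (memLp_one_iff_integrable.1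
          ((hBu C hC hCΩ).sub (hBh C hC hCΩ)).norm).mul_of_top_left hvC
    · simp [H, hx hxC]
  -- The strict inequality 0 < hi - u is essential: it makes every point leave S ε as ε decreases to
  -- 0. The contact set is treated separately.
  set S : ℝ → Set (Eucl n) := fun ε => {x | 0 < hi x - u x ∧ hi x - u x < ε * |v x|}
  have hum := hu.memW1pLoc.isWeakGradient.locallyIntegrableOn.aestronglyMeasurable.aemeasurable
  have hhm := hhi.mem.memW1pLoc.isWeakGradient.locallyIntegrableOn.aestronglyMeasurable.aemeasurable
  have hvm := hv.memW1pLoc.isWeakGradient.locallyIntegrableOn.aestronglyMeasurable.aemeasurable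
  have hS : ∀ ε, NullMeasurableSet (S ε) (volume.restrict (Ω : Set (Eucl n))) := fun ε =>
    (nullMeasurableSet_lt aemeasurable_const (hhm.sub hum)).inter
      (nullMeasurableSet_lt (hhm.sub hum) (hvm.abs.const_mul ε))
  have hSint : ∀ ε, IntegrableOn ((S ε).indicator H) (Ω : Set (Eucl n)) volume := fun ε =>
    hHint.indicator₀ (hS ε)
  have hmem : ∀ ε, MemW1pLocLinfLoc Ω p (fun x => max (u x + ε * v x - hi x) 0)
      ({x | 0 < u x + ε * v x - hi x}.indicator fun x => Gu x + ε • Gv x - Ghi x) := fun ε =>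
    ((hu.add (hv.const_mul ε)).sub hhi.mem).posPart
  refine ⟨fun ε => ∫ x in (Ω : Set (Eucl n)), (S ε).indicator H x, ?_, ?_⟩
  · have hlim : Tendsto (fun ε => ∫ x in (Ω : Set (Eucl n)), (S ε).indicator H x) (𝓝[>] 0)
        (𝓝 (∫ x in (Ω : Set (Eucl n)), (0 : ℝ))) := by
      refine tendsto_integral_filter_of_dominated_convergence H
        (Eventually.of_forall fun ε => (hSint ε).1)
        (Eventually.of_forall fun ε => Eventually.of_forall fun x => ?_) hHint
        (Eventually.of_forall fun x => ?_)
      · exact (norm_indicator_le_norm_self _ _).trans_eq (Real.norm_of_nonneg (hH0 x))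
      · refine tendsto_const_nhds.congr' ?_
        by_cases hx : 0 < hi x - u x
        · have h1 : Tendsto (fun ε : ℝ => ε * |v x|) (𝓝[>] 0) (𝓝 (0 * |v x|)) :=
            (tendsto_nhdsWithin_of_tendsto_nhds tendsto_id).mul_const _
          rw [zero_mul] at h1
          filter_upwards [h1.eventually_lt_const hx] with ε hε
          exact (Set.indicator_of_notMem (fun h => absurd h.2 hε.not_gt) _).symm
        · exact Eventually.of_forall fun ε => (Set.indicator_of_notMem (fun h => hx h.1) _).symm
    simpa using hlim
  -- On S ε this gives hi - u < ε|v| ≤ εM < r, so u is within the range of the Lipschitz condition.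
  have hsmall : ∀ᶠ ε in 𝓝[>] (0 : ℝ), ε * M < r := by
    have h1 : Tendsto (fun ε : ℝ => ε * M) (𝓝[>] 0) (𝓝 (0 * M)) :=
      (tendsto_nhdsWithin_of_tendsto_nhds tendsto_id).mul_const _
    rw [zero_mul] at h1
    exact h1.eventually_lt_const hr
  filter_upwards [hsmall, self_mem_nhdsWithin] with ε hεr hε
  have hε : 0 < ε := hε
  have hzc : MemLinfC Ω (fun x => max (u x + ε * v x - hi x) 0) := by
    refine hvc.of_abs_le (c := ε)
      (hmem ε).memW1pLoc.isWeakGradient.locallyIntegrableOn.aestronglyMeasurable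
      (hle.mono fun x hx => ?_)
    rw [abs_of_nonneg (le_max_right _ _)]
    refine max_le ?_ (by positivity)
    nlinarith [le_abs_self (v x)]
  refine ⟨hmem ε, hzc, ?_⟩
  have hIu := integrableOn_pairing_of_memLinfC hp hAu hBu (hmem ε) hzc
  have hIh := integrableOn_pairing_of_memLinfC hp hAh hBh (hmem ε) hzc
  have hsuper := integral_pairing_nonneg hp hAh hBh (fun φ hφ => hhi.weakForm_nonneg φ hφ)
    (hmem ε) hzc (Eventually.of_forall fun x => le_max_right _ _)
  have hlipΩ : ∀ᵐ x ∂(volume.restrict (Ω : Set (Eucl n))), x ∈ C → ∀ σ : ℝ, hi x - r ≤ σ →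
      σ ≤ hi x → ‖a x (hi x) (Ghi x) - a x σ (Ghi x)‖ ≤ γ x * (hi x - σ) :=
    ae_restrict_of_ae ((ae_restrict_iff' hC.measurableSet).1 hlipC)
  have hpt : ∀ᵐ x ∂(volume.restrict (Ω : Set (Eucl n))),
      -(ε * (S ε).indicator H x) ≤
        inner ℝ (Au x) (({x | 0 < u x + ε * v x - hi x}.indicator
            fun x => Gu x + ε • Gv x - Ghi x) x) + Bu x * max (u x + ε * v x - hi x) 0
        - (inner ℝ (Ah x) (({x | 0 < u x + ε * v x - hi x}.indicator
            fun x => Gu x + ε • Gv x - Ghi x) x) + Bh x * max (u x + ε * v x - hi x) 0) := by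
    filter_upwards [hle, hM, hv0, hlipΩ, hmono, hd.memW1pLoc.isWeakGradient.ae_eq_zero_of_eq_zero]
      with x hx hMx hv0x hlipx hmonox hgradx
    have hneg : -(ε * (S ε).indicator H x) ≤ 0 :=
      neg_nonpos.2 (mul_nonneg hε.le (Set.indicator_apply_nonneg fun _ => hH0 x))
    by_cases ht : 0 < u x + ε * v x - hi x
    · rw [Set.indicator_of_mem (show x ∈ {x | 0 < u x + ε * v x - hi x} from ht),
        max_eq_left ht.le]
      rcases hx.eq_or_lt with heq | hlt
      -- On the contact set u - hi vanishes, hence so does its gradient a.e.; the two fluxes and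
      -- sources then coincide and the integrand is zero.
      · have hG : Gu x = Ghi x := sub_eq_zero.1 (hgradx (sub_eq_zero.2 heq))
        simpa [Au, Ah, Bu, Bh, heq, hG] using hneg
      · have hvx : v x ≤ |v x| := le_abs_self _
        have hlt2 : hi x - u x < ε * |v x| := by nlinarith
        have hxS : x ∈ S ε := ⟨by linarith, hlt2⟩
        have hxC : x ∈ C := by
          by_contra h
          rw [(hv0x h).1, abs_zero, mul_zero] at hlt2
          linarith
        have hMr : ε * |v x| ≤ ε * M := mul_le_mul_of_nonneg_left hMx hε.le
        rw [Set.indicator_of_mem hxS]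
        exact truncation_pointwise_bound hε hlt ht (hmonox (u x) (Gu x) (Ghi x))
          (hlipx hxC (u x) (by linarith) hx)
    · rw [Set.indicator_of_notMem (show x ∉ {x | 0 < u x + ε * v x - hi x} from ht),
        max_eq_right (not_lt.1 ht)]
      simpa using hneg
  have hint := integral_mono_ae ((hSint ε).const_mul ε).neg (hIu.sub hIh) hpt
  simp only [Pi.neg_apply, Pi.sub_apply] at hint
  rw [integral_neg, integral_const_mul, integral_sub hIu hIh] at hint
  have hfin := hint.trans (sub_le_self _ hsuper)
  exact hfin

end

end QuasilinearObstacle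
-- Reflection u ↦ -u and conclusion.
namespace QuasilinearObstacle

noncomputable section

variable {n : ℕ} {Ω : Opens (Eucl n)} {p : ℝ}
  {a : Eucl n → ℝ → Eucl n → Eucl n} {b : Eucl n → ℝ → Eucl n → ℝ}

/-- The coefficient conjugate to `f` under the change of unknown `u ↦ -u`. -/
def reflect {F : Type*} [NormedAddCommGroup F] (f : Eucl n → ℝ → Eucl n → F) :
    Eucl n → ℝ → Eucl n → F := fun x s ξ => -f x (-s) (-ξ)

lemma IsCaratheodoryFun.reflect {F : Type*} [NormedAddCommGroup F]
    {f : Eucl n → ℝ → Eucl n → F} (hf : IsCaratheodoryFun Ω f) :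
    IsCaratheodoryFun Ω (reflect f) where
  aestronglyMeasurable s ξ := (hf.aestronglyMeasurable (-s) (-ξ)).neg
  continuous := hf.continuous.mono fun _ hx => (hx.comp continuous_neg).neg

lemma LocalNaturalGrowth.reflect (h : LocalNaturalGrowth Ω p a b) :
    LocalNaturalGrowth Ω p (reflect a) (reflect b) := by
  intro C hC hCΩ R hR
  obtain ⟨α₀, α₁, β, h₀, h₁, hβ, hx⟩ := h C hC hCΩ R hR
  refine ⟨α₀, α₁, β, h₀, h₁, hβ, hx.mono fun x hx s ξ hs => ?_⟩
  simpa [QuasilinearObstacle.reflect] using hx (-s) (-ξ) (by simpa using hs)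

lemma MonotoneInGradient.reflect (h : MonotoneInGradient Ω a) :
    MonotoneInGradient Ω (reflect a) := by
  refine h.mono fun x hx s ξ η => ?_
  have h1 := hx (-s) (-ξ) (-η)
  rw [← neg_sub' ξ η, inner_neg_right, ← inner_neg_left, neg_sub] at h1
  rwa [QuasilinearObstacle.reflect, QuasilinearObstacle.reflect, neg_sub_neg]

/-- The sign change turns subsolutions into supersolutions, so the estimate at an upper obstacle
also serves the lower one. -/
lemma weakForm_reflect (u v : Eucl n → ℝ) (Gu Gv : Eucl n → Eucl n) :
    weakForm Ω (reflect a) (reflect b) (fun x => -u x) (fun x => -Gu x) v Gv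
      = -weakForm Ω a b u Gu v Gv := by
  rw [weakForm, weakForm, ← integral_neg]
  refine integral_congr_ae (Eventually.of_forall fun x => ?_)
  simp only [weakIntegrand, reflect, neg_neg, inner_neg_left]
  ring

lemma IsSubsolution.reflect {w : Eucl n → ℝ} {G : Eucl n → Eucl n}
    (h : IsSubsolution Ω p a b w G) :
    IsSupersolution Ω p (reflect a) (reflect b) (fun x => -w x) (fun x => -G x) where
  mem := h.mem.neg
  weakForm_nonneg φ hφ := by
    rw [weakForm_reflect]
    exact neg_nonneg.2 (h.weakForm_nonpos φ hφ)

/-- The variational inequality, tested at u + εv truncated to the order interval, yields the sign up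
to the two truncation errors, which are o(ε). -/
lemma SolvesLocalVI.weakForm_nonneg_of_memLinfC (hp : 1 < p)
    (ha : IsCaratheodoryFun Ω a) (hb : IsCaratheodoryFun Ω b)
    (hgrowth : LocalNaturalGrowth Ω p a b) (hmono : MonotoneInGradient Ω a)
    {lo u hi v : Eucl n → ℝ} {Glo Gu Ghi Gv : Eucl n → Eucl n}
    (hlo : IsSubsolution Ω p a b lo Glo) (hhi : IsSupersolution Ω p a b hi Ghi)
    (hu : SolvesLocalVI Ω p a b lo hi u Gu)
    (hlip : LipschitzNearObstacles Ω p a lo Glo hi Ghi)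
    (hv : MemW1pLocLinfLoc Ω p v Gv) (hvc : MemLinfC Ω v) :
    0 ≤ weakForm Ω a b u Gu v Gv := by
  have hum := hu.mem.mem
  have hbet := hu.mem.between
  have hlip_hi : LipschitzBelow Ω p a hi Ghi := fun C hC hCΩ => by
    obtain ⟨r, γ, hr, hγ, h⟩ := hlip C hC hCΩ
    refine ⟨r, γ, hr, hγ, h.mono fun x hx σ h1 h2 => ?_⟩
    exact (hx (lo x) σ le_rfl (by linarith) h1 h2).2
  have hlip_lo : LipschitzBelow Ω p (reflect a) (fun x => -lo x) (fun x => -Glo x) :=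
    fun C hC hCΩ => by
      obtain ⟨r, γ, hr, hγ, h⟩ := hlip C hC hCΩ
      refine ⟨r, γ, hr, hγ, h.mono fun x hx σ h1 h2 => ?_⟩
      -- The joint condition is used with its second variable frozen at the upper obstacle, where
      -- the constraints on it hold trivially.
      have h3 := (hx (-σ) (hi x) (by linarith) (by linarith) (by linarith) le_rfl).1
      simp only [reflect, neg_neg, neg_sub_neg]
      convert h3 using 2
      ring
  have hvn : MemLinfC Ω (fun x => -v x) :=
    hvc.of_abs_le (c := 1) hv.neg.memW1pLoc.isWeakGradient.locallyIntegrableOn.aestronglyMeasurable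
      (Eventually.of_forall fun x => by simp)
  obtain ⟨e₁, he₁, hev₁⟩ := weakForm_truncation_lower_bound hp ha hb hgrowth hmono hum hhi
    (hbet.mono fun x hx => hx.2) hlip_hi hv hvc
  obtain ⟨e₂, he₂, hev₂⟩ := weakForm_truncation_lower_bound hp ha.reflect hb.reflect
    hgrowth.reflect hmono.reflect hum.neg hlo.reflect
    (hbet.mono fun x hx => neg_le_neg hx.1) hlip_lo hv.neg hvn
  have hAu := memLpLoc_flux hp ha hgrowth hum
  have hBu := memLpLoc_source hp hb hgrowth hum
  -- After division by ε, the inequality to be reached is W(v) ≥ -(e₁ + e₂), whose right side tends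
  -- to 0.
  have hlim : Tendsto (fun ε => -(e₁ ε + e₂ ε)) (𝓝[>] 0) (𝓝 0) := by
    simpa using (he₁.add he₂).neg
  refine le_of_tendsto hlim ?_
  filter_upwards [hev₁, hev₂, self_mem_nhdsWithin] with ε h₁ h₂ hε
  have hε : 0 < ε := hε
  obtain ⟨hz, hzc, hzb⟩ := h₁
  obtain ⟨hy, hyc, hyb⟩ := h₂
  rw [weakForm_reflect] at hyb
  set z := fun x => max (u x + ε * v x - hi x) 0 with hzdef
  set Gz := {x | 0 < u x + ε * v x - hi x}.indicator fun x => Gu x + ε • Gv x - Ghi x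
  set y := fun x => max (-u x + ε * -v x - -lo x) 0 with hydef
  set Gy := {x | 0 < -u x + ε * -v x - -lo x}.indicator fun x => -Gu x + ε • -Gv x - -Glo x
  have hIv := integrableOn_pairing_of_memLinfC hp hAu hBu hv hvc
  have hIz := integrableOn_pairing_of_memLinfC hp hAu hBu hz hzc
  have hIy := integrableOn_pairing_of_memLinfC hp hAu hBu hy hyc
  have hvε := ((hum.add (hv.const_mul ε)).add hy).sub hz
  -- Because lo ≤ u ≤ hi, truncation can only bring u + εv closer to u; the bound ε|v| then gives
  -- the competitor's difference from u compact support.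
  have hcases : ∀ᵐ x ∂(volume.restrict (Ω : Set (Eucl n))),
      (lo x ≤ u x + ε * v x + y x - z x ∧ u x + ε * v x + y x - z x ≤ hi x) ∧
        |u x + ε * v x + y x - z x - u x| ≤ ε * |v x| := by
    filter_upwards [hbet] with x hx
    have hv1 : ε * v x ≤ ε * |v x| := mul_le_mul_of_nonneg_left (le_abs_self _) hε.le
    have hv2 : -(ε * |v x|) ≤ ε * v x := by
      rw [← mul_neg]
      exact mul_le_mul_of_nonneg_left (neg_abs_le _) hε.le
    have hv3 : ε * -v x = -(ε * v x) := mul_neg _ _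
    simp only [hydef, hzdef, hv3, abs_le]
    rcases max_cases (-u x + -(ε * v x) - -lo x) 0 with ⟨e1, _⟩ | ⟨e1, _⟩ <;>
      rcases max_cases (u x + ε * v x - hi x) 0 with ⟨e2, _⟩ | ⟨e2, _⟩ <;>
      rw [e1, e2] <;> refine ⟨⟨?_, ?_⟩, ?_, ?_⟩ <;> linarith
  have hdiff : MemLinfC Ω (fun x => u x + ε * v x + y x - z x - u x) :=
    hvc.of_abs_le (hvε.sub hum).memW1pLoc.isWeakGradient.locallyIntegrableOn.aestronglyMeasurable
      (hcases.mono fun x hx => hx.2)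
  have hVI := hu.weakForm_nonneg _ _ ⟨hvε, hcases.mono fun x hx => hx.1⟩ hdiff
  have hlin : weakForm Ω a b u Gu (fun x => u x + ε * v x + y x - z x - u x)
      (fun x => Gu x + ε • Gv x + Gy x - Gz x - Gu x)
      = ε * weakForm Ω a b u Gu v Gv + weakForm Ω a b u Gu y Gy - weakForm Ω a b u Gu z Gz := by
    simp only [weakForm, weakIntegrand]
    rw [← integral_const_mul, ← integral_add (hIv.const_mul ε) hIy]
    refine Eq.trans ?_ (integral_sub ((hIv.const_mul ε).add hIy) hIz)
    refine integral_congr_ae (Eventually.of_forall fun x => ?_)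
    simp only [inner_sub_right, inner_add_right, inner_smul_right]
    ring
  rw [hlin] at hVI
  have hfin : 0 ≤ ε * (weakForm Ω a b u Gu v Gv + (e₁ ε + e₂ ε)) := by linarith
  linarith [nonneg_of_mul_nonneg_right hfin hε]

end

end QuasilinearObstacle

open QuasilinearObstacle in
theorem theorem3p2 {n : ℕ} (Ω : Opens (Eucl n)) (p : ℝ) (hp : 1 < p)
    (a : Eucl n → ℝ → Eucl n → Eucl n) (b : Eucl n → ℝ → Eucl n → ℝ)
    (ha : IsCaratheodoryFun Ω a) (hb : IsCaratheodoryFun Ω b)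
    (hgrowth : LocalNaturalGrowth Ω p a b)
    (hmono : MonotoneInGradient Ω a)
    (lo u hi : Eucl n → ℝ) (Glo Gu Ghi : Eucl n → Eucl n)
    (hlo : IsSubsolution Ω p a b lo Glo)
    (hhi : IsSupersolution Ω p a b hi Ghi)
    (hu : SolvesLocalVI Ω p a b lo hi u Gu)
    (hlip : LipschitzNearObstacles Ω p a lo Glo hi Ghi) :
    ∀ (v : Eucl n → ℝ) (Gv : Eucl n → Eucl n), MemW1pZero Ω p v Gv → MemLinfC Ω v →
      IntegrableOn (weakIntegrand a b u Gu v Gv) (Ω : Set (Eucl n)) volume ∧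
        weakForm Ω a b u Gu v Gv = 0 := by
  intro v Gv hv0 hvc
  have hv := hv0.memW1pLocLinfLoc hvc
  have hvn : MemLinfC Ω (fun x => -v x) :=
    hvc.of_abs_le (c := 1) hv.neg.memW1pLoc.isWeakGradient.locallyIntegrableOn.aestronglyMeasurable
      (Eventually.of_forall fun x => by simp)
  refine ⟨integrableOn_pairing_of_memLinfC hp (memLpLoc_flux hp ha hgrowth hu.mem.mem)
    (memLpLoc_source hp hb hgrowth hu.mem.mem) hv hvc, le_antisymm ?_ ?_⟩
  -- The form is odd in the test function, so the one-sided inequality at -v is the reverse one at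
  -- v.
  · have h := hu.weakForm_nonneg_of_memLinfC hp ha hb hgrowth hmono hlo hhi hlip hv.neg hvn
    have hneg : weakForm Ω a b u Gu (fun x => -v x) (fun x => -Gv x)
        = -weakForm Ω a b u Gu v Gv := by
      rw [weakForm, weakForm, ← integral_neg]
      refine integral_congr_ae (Eventually.of_forall fun x => ?_)
      simp only [weakIntegrand, inner_neg_right]
      ring
    linarith
  · exact hu.weakForm_nonneg_of_memLinfC hp ha hb hgrowth hmono hlo hhi hlip hv hvc
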